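/- Let $d\ge 0$, let $\varphi:\mathbb R^d\to\mathbb R$ be $K$-Lipschitz, and suppose that $y\mapsto\varphi(y)-\tfrac{\lambda}{2}|y|^2$ is concave for some $\lambda\ge0$. For $\varepsilon,t>0$ let $$u^\varepsilon_t(x)=-\varepsilon\log\left(\frac1{(2\pi\varepsilon t)^{d/2}}\int_{\mathbb R^d}\exp\Bigl(-\frac{|x-y|^2}{2\varepsilon t}-\frac{\varphi(y)}{\varepsilon}\Bigr)\,dy\right)$$ be the Cole-Hopf solution of $\partial_t u+\tfrac12|\nabla u|^2=\tfrac{\varepsilon}{2}\Delta u$ with initial value $\varphi$, let $v^\varepsilon_t=\nabla u^\varepsilon_t$, and let $X^\varepsilon_t(y)$, $t\ge0$, be the Lagrangian flow: for every $y\in\mathbb R^d$ the path $t\mapsto X^\varepsilon_t(y)$ is continuous on $[0,\infty)$, $X^\varepsilon_0(y)=y$, and $\partial_tX^\varepsilon_t(y)=v^\varepsilon_t(X^\varepsilon_t(y))$ for all $t>0$. Let $\rho^\varepsilon_t$ be the viscous mass measure, which has density $x\mapsto(\det\nabla X^\varepsilon_t(y))^{-1}$, $x=X^\varepsilon_t(y)$,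 with respect to Lebesgue measure $\mathcal L$ on $\mathbb R^d$; equivalently $\rho^\varepsilon_t=(X^\varepsilon_t)_\sharp\mathcal L$. Then the flows $X^\varepsilon$ exist for all $\varepsilon>0$, and $X^\varepsilon_t(y)$ converges as $\varepsilon\to0$, uniformly for $(y,t)$ in compact subsets of $\mathbb R^d\times[0,\infty)$, to a limit $X_t(y)$. For $t\ge0$ put $\rho_t=(X_t)_\sharp\mathcal L$. All measures $\rho^\varepsilon_t$ and $\rho_t$ are locally finite, and (i) for each $t\ge0$, $\rho^\varepsilon_t$ converges locally weak-$\star$ to $\rho_t$ as $\varepsilon\to0$; (ii) $\rho_t$ converges locally weak-$\star$ to $\mathcal L$ as $t\to0$. Here local weak-$\star$ convergence of measures $\mu^s\to\mu$ means $\int g\,d\mu^s\to\int g\,d\mu$ for every continuous $g:\mathbb R^d\to\mathbb R$ with compact support. -/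

import Mathlib

open MeasureTheory Filter Topology Set
open scoped NNReal ENNReal

namespace AdhesionModel

/-- A function is `lam`-concave if subtracting `(lam / 2) |y|²` makes it concave. -/
def LambdaConcave {d : ℕ} (lam : ℝ) (φ : EuclideanSpace ℝ (Fin d) → ℝ) : Prop :=
  ConcaveOn ℝ univ (fun y => φ y - lam / 2 * ‖y‖ ^ 2)

/-- The Cole-Hopf solution `u^ε_t(x)` of the potential Burgers equation
`∂ₜ u + |∇u|² / 2 = (ε / 2) Δ u` with initial value `φ`, for `ε, t > 0`. -/
noncomputable def colePotential {d : ℕ} (φ : EuclideanSpace ℝ (Fin d) → ℝ) (ε t : ℝ)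
    (x : EuclideanSpace ℝ (Fin d)) : ℝ :=
  -ε * Real.log (1 / (2 * Real.pi * ε * t) ^ ((d : ℝ) / 2) *
    ∫ y, Real.exp (-‖x - y‖ ^ 2 / (2 * ε * t) - φ y / ε))

/-- The viscous velocity field `v^ε_t = ∇ u^ε_t`. -/
noncomputable def velocity {d : ℕ} (φ : EuclideanSpace ℝ (Fin d) → ℝ) (ε t : ℝ)
    (x : EuclideanSpace ℝ (Fin d)) : EuclideanSpace ℝ (Fin d) :=
  gradient (colePotential φ ε t) x

/-- `Y y t` (for `t ≥ 0`) is the Lagrangian flow of the viscous velocity field: every path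
`t ↦ Y y t` is continuous on `[0, ∞)`, starts at `y`, and satisfies
`∂ₜ Y = v^ε_t(Y)` for all `t > 0`. The values at negative times play no role. -/
structure IsLagrangianFlow {d : ℕ} (φ : EuclideanSpace ℝ (Fin d) → ℝ) (ε : ℝ)
    (Y : EuclideanSpace ℝ (Fin d) → ℝ → EuclideanSpace ℝ (Fin d)) : Prop where
  initial : ∀ y, Y y 0 = y
  continuousOn : ∀ y, ContinuousOn (Y y) (Ici 0)
  hasDerivAt : ∀ y, ∀ t, 0 < t → HasDerivAt (Y y) (velocity φ ε t (Y y t)) t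

/-- The mass density transported by a diffeomorphism `F` from the uniform density `1`:
`x ↦ (det ∇F(y))⁻¹`, where `x = F(y)`. -/
noncomputable def transportedDensity {d : ℕ}
    (F : EuclideanSpace ℝ (Fin d) → EuclideanSpace ℝ (Fin d))
    (x : EuclideanSpace ℝ (Fin d)) : ℝ :=
  ((fderiv ℝ F (Function.invFun F x)).det)⁻¹

/-- The measure `ρ^ε_t` whose Lebesgue density is the mass density transported by the map
`F = X^ε_t`. -/
noncomputable def viscousMass {d : ℕ}
    (F : EuclideanSpace ℝ (Fin d) → EuclideanSpace ℝ (Fin d)) :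
    Measure (EuclideanSpace ℝ (Fin d)) :=
  volume.withDensity (fun x => ENNReal.ofReal (transportedDensity F x))

/-- Local weak-star convergence `μ s → ν` as `s → 0⁺`: convergence of the integrals of all
continuous functions with compact support (used for locally finite measures). -/
def LocallyWeakStarTendsto {d : ℕ} (μ : ℝ → Measure (EuclideanSpace ℝ (Fin d)))
    (ν : Measure (EuclideanSpace ℝ (Fin d))) : Prop :=
  ∀ g : EuclideanSpace ℝ (Fin d) → ℝ, Continuous g → HasCompactSupport g →
    Tendsto (fun s => ∫ x, g x ∂(μ s)) (𝓝[>] 0) (𝓝 (∫ x, g x ∂ν))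

end AdhesionModel

/-!
By the Cole-Hopf formula, the velocity `v^ε_t` is `-√(ε / t)` times the mean of the Gaussian weight
`w ↦ exp (-|w|² / 2 - φ (x + √(ε t) w) / ε)`. In the time variable `s = √t` the velocity field is
therefore continuous, bounded and Lipschitz in space up to `s = 0`, so the Picard-Lindelöf theorem
gives the flow. The flow map over a long time is a composition of maps close to the identity, hence
bi-Lipschitz with positive Jacobian almost everywhere, and the change of variables formula
identifies the viscous mass with the push-forward of the Lebesgue measure.

As `ε → 0`, Laplace's method shows that the Cole-Hopf potentials converge, uniformly in space, to
the Hopf-Lax potential. By Hölder's inequality they stay `λ`-concave, so two potentials at uniform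
distance `e` satisfy `⟨a - b, v^ε(a) - v^δ(b)⟩ ≤ 2 e + λ |a - b|²`. Grönwall's inequality then makes
the flows uniformly Cauchy. All maps move points by at most `K t`, which gives local finiteness and,
by dominated convergence, the weak-star limits.
-/

namespace AdhesionModel

section OrientedBilipschitz

variable {E : Type*} [NormedAddCommGroup E] [NormedSpace ℝ E] [FiniteDimensional ℝ E]

theorem det_one_add_pos {A : E →L[ℝ] E} (hA : ‖A‖ < 1) : 0 < (1 + A).det := by
  have det_ne_zero : ∀ s ∈ Icc (0 : ℝ) 1, (1 + s • A).det ≠ 0 := by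
    intro s hs
    have norm_lt : ‖-(s • A)‖ < 1 := by
      rw [norm_neg, norm_smul, Real.norm_of_nonneg hs.1]
      exact (mul_le_of_le_one_left (norm_nonneg _) hs.2).trans_lt hA
    have isUnit : IsUnit (1 + s • A) := by simpa using isUnit_one_sub_of_norm_lt_one norm_lt
    exact (LinearMap.isUnit_det _ (isUnit.map
      (ContinuousLinearMap.toLinearMapRingHom : (E →L[ℝ] E) →+* (E →ₗ[ℝ] E)))).ne_zero
  have det_zero : (1 + (0 : ℝ) • A).det = 1 := by
    rw [zero_smul, add_zero]; exact LinearMap.det_id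
  have det_cont : ContinuousOn (fun s : ℝ => (1 + s • A).det) (Icc 0 1) :=
    (ContinuousLinearMap.continuous_det.comp (by fun_prop)).continuousOn
  by_contra! hneg
  obtain ⟨s, hs, hs0⟩ : (0 : ℝ) ∈ (fun s : ℝ => (1 + s • A).det) '' Icc 0 1 :=
    intermediate_value_Icc' zero_le_one det_cont
      ⟨by simpa using hneg, by simp only [det_zero, zero_le_one]⟩
  exact det_ne_zero s hs hs0

variable [MeasurableSpace E] [BorelSpace E]

theorem addHaar_eq_zero_iff_hausdorffMeasure (μ : Measure E) [μ.IsAddHaarMeasure] {s : Set E} :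
    μ s = 0 ↔ μH[Module.finrank ℝ E] s = 0 :=
  ⟨fun h => Measure.absolutelyContinuous_isAddHaarMeasure _ μ h,
    fun h => Measure.absolutelyContinuous_isAddHaarMeasure μ _ h⟩

theorem addHaar_preimage_eq_zero_of_antilipschitz (μ : Measure E) [μ.IsAddHaarMeasure]
    {F : E → E} {C : ℝ≥0} (hF : AntilipschitzWith C F) {s : Set E} (hs : μ s = 0) :
    μ (F ⁻¹' s) = 0 := by
  rw [addHaar_eq_zero_iff_hausdorffMeasure] at hs ⊢
  simpa [hs] using hF.hausdorffMeasure_preimage_le (d := Module.finrank ℝ E) (by positivity) s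

theorem addHaar_image_eq_zero_of_lipschitz (μ : Measure E) [μ.IsAddHaarMeasure]
    {F : E → E} {C : ℝ≥0} (hF : LipschitzWith C F) {s : Set E} (hs : μ s = 0) :
    μ (F '' s) = 0 := by
  rw [addHaar_eq_zero_iff_hausdorffMeasure] at hs ⊢
  simpa [hs] using hF.hausdorffMeasure_image_le (d := Module.finrank ℝ E) (by positivity) s

/-- An oriented bi-Lipschitz map: a bi-Lipschitz bijection whose derivative, which exists almost
everywhere by Rademacher's theorem, has positive determinant almost everywhere. Flow maps of
Lipschitz velocity fields are of this kind, and it is what the change of variables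
`viscousMass_eq_map` needs. -/
structure IsOrientedBilipschitz (μ : Measure E) (F : E → E) : Prop where
  bijective : Function.Bijective F
  lipschitz : ∃ C : ℝ≥0, LipschitzWith C F
  antilipschitz : ∃ C : ℝ≥0, AntilipschitzWith C F
  ae_det_pos : ∀ᵐ y ∂μ, DifferentiableAt ℝ F y ∧ 0 < (fderiv ℝ F y).det

omit [FiniteDimensional ℝ E] [BorelSpace E] in
theorem IsOrientedBilipschitz.id (μ : Measure E) : IsOrientedBilipschitz μ (_root_.id : E → E) where
  bijective := Function.bijective_id
  lipschitz := ⟨1, LipschitzWith.id⟩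
  antilipschitz := ⟨1, AntilipschitzWith.id⟩
  ae_det_pos := Eventually.of_forall fun y => by
    have det_id : (ContinuousLinearMap.id ℝ E).det = 1 := LinearMap.det_id
    exact ⟨differentiableAt_id, by rw [fderiv_id, det_id]; exact one_pos⟩

theorem IsOrientedBilipschitz.comp {μ : Measure E} [μ.IsAddHaarMeasure] {F G : E → E}
    (hG : IsOrientedBilipschitz μ G) (hF : IsOrientedBilipschitz μ F) :
    IsOrientedBilipschitz μ (G ∘ F) := by
  obtain ⟨C, hC⟩ := hF.lipschitz
  obtain ⟨C', hC'⟩ := hG.lipschitz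
  obtain ⟨c, hc⟩ := hF.antilipschitz
  obtain ⟨c', hc'⟩ := hG.antilipschitz
  refine ⟨hG.bijective.comp hF.bijective, ⟨_, hC'.comp hC⟩, ⟨_, hc'.comp hc⟩, ?_⟩
  have ae_det_pos_comp : ∀ᵐ y ∂μ, DifferentiableAt ℝ G (F y) ∧ 0 < (fderiv ℝ G (F y)).det :=
    addHaar_preimage_eq_zero_of_antilipschitz μ hc hG.ae_det_pos
  filter_upwards [ae_det_pos_comp, hF.ae_det_pos] with y hGy hFy
  have det_comp : ((fderiv ℝ G (F y)).comp (fderiv ℝ F y)).det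
      = (fderiv ℝ G (F y)).det * (fderiv ℝ F y).det := LinearMap.det_comp _ _
  refine ⟨hGy.1.comp y hFy.1, ?_⟩
  rw [fderiv_comp y hGy.1 hFy.1, det_comp]
  exact mul_pos hGy.2 hFy.2

theorem IsOrientedBilipschitz.of_lipschitzWith_sub_id {μ : Measure E} [μ.IsAddHaarMeasure]
    {G : E → E} {c : ℝ≥0} (hc : c < 1) (h : LipschitzWith c (fun y => G y - y)) :
    IsOrientedBilipschitz μ G := by
  have lipschitz : LipschitzWith (c + 1) G := by simpa using h.add LipschitzWith.id
  have antilipschitz : AntilipschitzWith (1⁻¹ - c)⁻¹ G := by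
    simpa using AntilipschitzWith.id.add_lipschitzWith h (by simpa using hc)
  have approximates : ApproximatesLinearOn G
      ((ContinuousLinearEquiv.refl ℝ E : E ≃L[ℝ] E) : E →L[ℝ] E) univ c := by
    intro x _ y _
    simpa [sub_sub_sub_comm] using h.norm_sub_le x y
  have small : Subsingleton E ∨ c < ‖((ContinuousLinearEquiv.refl ℝ E).symm : E →L[ℝ] E)‖₊⁻¹ := by
    rcases subsingleton_or_nontrivial E with hE | hE
    · exact Or.inl hE
    · exact Or.inr (by simpa using hc)
  refine ⟨(approximates.toHomeomorph G small).bijective, ⟨_, lipschitz⟩, ⟨_, antilipschitz⟩, ?_⟩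
  filter_upwards [lipschitz.ae_differentiableAt (μ := μ)] with y hy
  have fderiv_sub_id : fderiv ℝ (fun y => G y - y) y = fderiv ℝ G y - 1 := by
    rw [fderiv_fun_sub hy differentiableAt_fun_id, fderiv_fun_id]; rfl
  have norm_lt : ‖fderiv ℝ G y - 1‖ < 1 := by
    rw [← fderiv_sub_id]
    exact (norm_fderiv_le_of_lipschitz ℝ h).trans_lt (by exact_mod_cast hc)
  exact ⟨hy, by simpa using det_one_add_pos norm_lt⟩

end OrientedBilipschitz

theorem viscousMass_eq_map {d : ℕ} {F : EuclideanSpace ℝ (Fin d) → EuclideanSpace ℝ (Fin d)}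
    (hF : IsOrientedBilipschitz volume F) : viscousMass F = Measure.map F volume := by
  obtain ⟨C, hC⟩ := hF.lipschitz
  have hFm : Measurable F := hC.continuous.measurable
  obtain ⟨N, hsub, hNm, hN0⟩ := exists_measurable_superset_of_null hF.ae_det_pos
  have regular : ∀ y ∈ Nᶜ, DifferentiableAt ℝ F y ∧ 0 < (fderiv ℝ F y).det := fun y hy =>
    by_contra fun h => hy (hsub h)
  have image_ae_eq : F '' Nᶜ =ᵐ[volume] univ := by
    rw [ae_eq_univ, ← image_compl_eq hF.bijective, compl_compl]
    exact addHaar_image_eq_zero_of_lipschitz volume hC hN0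
  have compl_ae_eq : (Nᶜ : Set (EuclideanSpace ℝ (Fin d))) =ᵐ[volume] univ := by
    rwa [ae_eq_univ, compl_compl]
  have integrand_eq (s : Set (EuclideanSpace ℝ (Fin d))) : EqOn (fun y =>
      ENNReal.ofReal |(fderiv ℝ F y).det| *
        s.indicator (fun x => ENNReal.ofReal (transportedDensity F x)) (F y))
      ((F ⁻¹' s).indicator 1) Nᶜ := by
    intro y hy
    have hdet := (regular y hy).2
    by_cases hys : F y ∈ s
    · simp [hys, transportedDensity, Function.leftInverse_invFun hF.bijective.1 y, abs_of_pos hdet,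
        ENNReal.ofReal_inv_of_pos hdet, ENNReal.mul_inv_cancel, hdet]
    · simp [hys]
  ext s hs
  calc viscousMass F s
      = ∫⁻ x in F '' Nᶜ, s.indicator (fun x => ENNReal.ofReal (transportedDensity F x)) x := by
        rw [viscousMass, withDensity_apply _ hs, ← lintegral_indicator hs,
          setLIntegral_congr image_ae_eq, setLIntegral_univ]
    _ = ∫⁻ y in Nᶜ, (F ⁻¹' s).indicator 1 y := by
        rw [lintegral_image_eq_lintegral_abs_det_fderiv_mul volume hNm.compl
          (fun y hy => (regular y hy).1.hasFDerivAt.hasFDerivWithinAt) hF.bijective.1.injOn,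
          setLIntegral_congr_fun hNm.compl (integrand_eq s)]
    _ = Measure.map F volume s := by
        rw [setLIntegral_congr compl_ae_eq, setLIntegral_univ, lintegral_indicator_one (hFm hs),
          Measure.map_apply hFm hs]

section OrdinaryDifferentialEquations

theorem le_exp_mul_of_hasDerivAt_le {q q' : ℝ → ℝ} {a b c m : ℝ} (hab : a ≤ b) (hc : 0 ≤ c)
    (hm : 0 ≤ m) (hq : ContinuousOn q (Icc a b)) (hd : ∀ s ∈ Ioo a b, HasDerivAt q (q' s) s)
    (hle : ∀ s ∈ Ioo a b, q' s ≤ c * q s + m) :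
    q b ≤ Real.exp (c * (b - a)) * (q a + m * (b - a)) := by
  have hderiv : ∀ s ∈ Ioo a b, HasDerivAt (fun s => Real.exp (-c * (s - a)) * q s - m * s)
      (Real.exp (-c * (s - a)) * (-c) * q s + Real.exp (-c * (s - a)) * q' s - m) s := by
    intro s hs
    have hexponent : HasDerivAt (fun s : ℝ => -c * (s - a)) (-c) s := by
      simpa using ((hasDerivAt_id s).sub_const a).const_mul (-c)
    exact (hexponent.exp.mul (hd s hs)).sub (by simpa using (hasDerivAt_id s).const_mul m)
  have antitone : AntitoneOn (fun s => Real.exp (-c * (s - a)) * q s - m * s) (Icc a b) := by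
    refine antitoneOn_of_hasDerivWithinAt_nonpos (convex_Icc a b) (by fun_prop)
      (fun s hs => (hderiv s (by rwa [interior_Icc] at hs)).hasDerivWithinAt) fun s hs => ?_
    rw [interior_Icc] at hs
    have exp_le_one : Real.exp (-c * (s - a)) ≤ 1 :=
      Real.exp_le_one_iff.2 (by nlinarith [hs.1])
    nlinarith [hle s hs, Real.exp_pos (-c * (s - a))]
  have hend : Real.exp (-c * (b - a)) * q b ≤ q a + m * (b - a) := by
    have := antitone (left_mem_Icc.2 hab) (right_mem_Icc.2 hab) hab
    simp only [sub_self, mul_zero, Real.exp_zero, one_mul] at this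
    linarith
  calc q b = Real.exp (c * (b - a)) * (Real.exp (-c * (b - a)) * q b) := by
        rw [← mul_assoc, ← Real.exp_add]; simp
    _ ≤ _ := by gcongr

theorem mem_nhdsWithin_Ici_Icc_add_one (t : ℝ) : Icc 0 (t + 1) ∈ 𝓝[Ici 0] t := by
  simpa [← Ici_inter_Iic] using inter_mem_nhdsWithin (Ici 0) (Iic_mem_nhds (lt_add_one t))

theorem continuousOn_comp_of_lipschitzWith {X : Type*} [PseudoEMetricSpace X] {w : ℝ → X → X}
    {z : ℝ → X}
    (hL : ∀ T : ℝ, ∃ L : ℝ≥0, ∀ t ∈ Icc 0 T, LipschitzWith L (w t))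
    (hcont : ∀ x, ContinuousOn (fun t => w t x) (Ici 0)) (hz : ContinuousOn z (Ici 0)) :
    ContinuousOn (fun t => w t (z t)) (Ici 0) := by
  intro t (ht : 0 ≤ t)
  obtain ⟨L, hL⟩ := hL (t + 1)
  have joint : ContinuousOn (fun p : ℝ × X => w p.1 p.2) (Icc 0 (t + 1) ×ˢ univ) :=
    continuousOn_prod_of_continuousOn_lipschitzOnWith' _ L
      (fun s hs => (hL s hs).lipschitzOnWith) fun x _ => (hcont x).mono Icc_subset_Ici_self
  have hcomp : ContinuousOn (fun s => w s (z s)) (Icc 0 (t + 1)) :=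
    joint.comp (continuousOn_id.prodMk (hz.mono Icc_subset_Ici_self)) fun s hs => ⟨hs, mem_univ _⟩
  exact (hcomp t ⟨ht, (lt_add_one t).le⟩).mono_of_mem_nhdsWithin (mem_nhdsWithin_Ici_Icc_add_one t)

variable {E : Type*} [NormedAddCommGroup E] [NormedSpace ℝ E]

theorem norm_sub_le_of_hasDerivAt_Ioo {f f' : ℝ → E} {a b : ℝ} {C : ℝ≥0} (hab : a < b)
    (hf : ContinuousOn f (Icc a b)) (hd : ∀ s ∈ Ioo a b, HasDerivAt f (f' s) s)
    (hle : ∀ s ∈ Ioo a b, ‖f' s‖ ≤ C) : ‖f b - f a‖ ≤ C * (b - a) := by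
  have lipschitz : LipschitzOnWith C f (Ioo a b) :=
    (convex_Ioo a b).lipschitzOnWith_of_nnnorm_hasDerivWithin_le
      (fun s hs => (hd s hs).hasDerivWithinAt) hle
  rw [← closure_Ioo hab.ne] at hf
  have := (lipschitz.closure hf).norm_sub_le
    (by rw [closure_Ioo hab.ne]; exact right_mem_Icc.2 hab.le)
    (by rw [closure_Ioo hab.ne]; exact left_mem_Icc.2 hab.le)
  rwa [Real.norm_of_nonneg (sub_nonneg.2 hab.le)] at this

variable {w : ℝ → E → E} {z z' : ℝ → E} {a b : ℝ} {L : ℝ≥0}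

theorem hasDerivWithinAt_Ici_of_isIntegralCurveOn_Icc (hz : IsIntegralCurveOn z w (Icc a b))
    {t : ℝ} (ht : t ∈ Ico a b) : HasDerivWithinAt z (w t (z t)) (Ici t) t :=
  (hz t (Ico_subset_Icc_self ht)).mono_of_mem_nhdsWithin (Icc_mem_nhdsGE_of_mem ht)

theorem norm_sub_le_of_isIntegralCurveOn (hz : IsIntegralCurveOn z w (Icc a b))
    (hz' : IsIntegralCurveOn z' w (Icc a b)) (hL : ∀ t ∈ Ico a b, LipschitzWith L (w t)) {t : ℝ}
    (ht : t ∈ Icc a b) : ‖z t - z' t‖ ≤ ‖z a - z' a‖ * Real.exp (L * (t - a)) := by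
  simpa only [dist_eq_norm] using dist_le_of_trajectories_ODE_of_mem (s := fun _ => univ)
    (fun t ht => (hL t ht).lipschitzOnWith) hz.continuousOn
    (fun t => hasDerivWithinAt_Ici_of_isIntegralCurveOn_Icc hz) (fun _ _ => mem_univ _)
    hz'.continuousOn (fun t => hasDerivWithinAt_Ici_of_isIntegralCurveOn_Icc hz')
    (fun _ _ => mem_univ _) le_rfl t ht

theorem eqOn_Icc_of_isIntegralCurveOn (hz : IsIntegralCurveOn z w (Icc a b))
    (hz' : IsIntegralCurveOn z' w (Icc a b)) (hL : ∀ t ∈ Ico a b, LipschitzWith L (w t))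
    (h : z a = z' a) : EqOn z z' (Icc a b) := fun t ht => by
  simpa [h, sub_eq_zero] using norm_sub_le_of_isIntegralCurveOn hz hz' hL ht

theorem norm_sub_sub_sub_le_of_isIntegralCurveOn (hab : a ≤ b)
    (hz : IsIntegralCurveOn z w (Icc a b)) (hz' : IsIntegralCurveOn z' w (Icc a b))
    (hL : ∀ t ∈ Ico a b, LipschitzWith L (w t)) :
    ‖(z b - z' b) - (z a - z' a)‖ ≤
      L * (b - a) * Real.exp (L * (b - a)) * ‖z a - z' a‖ := by
  have hderiv_le : ∀ t ∈ Ico a b,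
      ‖w t (z t) - w t (z' t)‖ ≤ L * (‖z a - z' a‖ * Real.exp (L * (b - a))) := by
    intro t ht
    refine ((hL t ht).norm_sub_le _ _).trans ?_
    gcongr
    refine (norm_sub_le_of_isIntegralCurveOn hz hz' hL (Ico_subset_Icc_self ht)).trans ?_
    gcongr
    exact ht.2.le
  have := norm_image_sub_le_of_norm_deriv_le_segment' (f := fun t => z t - z' t)
    (fun t ht => (hz t ht).sub (hz' t ht)) hderiv_le b (right_mem_Icc.2 hab)
  linarith

theorem isIntegralCurveOn_Ici_of_hasDerivAt (hz : ContinuousOn z (Ici a))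
    (hd : ∀ t, a < t → HasDerivAt z (w t (z t)) t)
    (hw : ContinuousOn (fun t => w t (z t)) (Ici a)) : IsIntegralCurveOn z w (Ici a) := by
  intro t (ht : a ≤ t)
  rcases ht.eq_or_lt with rfl | hlt
  · refine hasDerivWithinAt_Ici_of_tendsto_deriv (s := Ioi a)
      (fun s hs => (hd s hs).differentiableAt.differentiableWithinAt)
      ((hz a self_mem_Ici).mono Ioi_subset_Ici_self) self_mem_nhdsWithin ?_
    refine ((hw a self_mem_Ici).mono Ioi_subset_Ici_self).tendsto.congr' ?_
    filter_upwards [self_mem_nhdsWithin] with s hs using (hd s hs).deriv.symm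
  · exact (hd t hlt).hasDerivWithinAt

theorem exists_isIntegralCurveOn_Icc [CompleteSpace E] {T : ℝ} (hT : 0 ≤ T) {B : ℝ≥0}
    (hL : ∀ t ∈ Icc 0 T, LipschitzWith L (w t))
    (hcont : ∀ x, ContinuousOn (fun t => w t x) (Icc 0 T))
    (hB : ∀ t ∈ Icc 0 T, ∀ x, ‖w t x‖ ≤ B) (x : E) :
    ∃ z, z 0 = x ∧ IsIntegralCurveOn z w (Icc 0 T) := by
  have picard : IsPicardLindelof w (⟨0, left_mem_Icc.2 hT⟩ : Icc (0 : ℝ) T) x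
      (B * T.toNNReal) 0 B L :=
    { lipschitzOnWith := fun t ht => (hL t ht).lipschitzOnWith
      continuousOn := fun x _ => hcont x
      norm_le := fun t ht x _ => hB t ht x
      mul_max_le := by simp [hT] }
  exact picard.exists_eq_forall_mem_Icc_hasDerivWithinAt₀

theorem isIntegralCurveOn_Ici_of_eqOn_Icc {Z : ℝ → ℝ → E} (hz : ∀ T, 0 ≤ T → EqOn z (Z T) (Icc 0 T))
    (hZ : ∀ T, 0 ≤ T → IsIntegralCurveOn (Z T) w (Icc 0 T)) : IsIntegralCurveOn z w (Ici 0) := by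
  intro t (ht : 0 ≤ t)
  have ht' : t ∈ Icc 0 (t + 1) := ⟨ht, (lt_add_one t).le⟩
  have heq := hz (t + 1) (by linarith)
  rw [heq ht']
  exact ((hZ (t + 1) (by linarith) t ht').congr heq (heq ht')).mono_of_mem_nhdsWithin
    (mem_nhdsWithin_Ici_Icc_add_one t)

theorem exists_isIntegralCurveOn_Ici [CompleteSpace E]
    (hL : ∀ T : ℝ, ∃ L : ℝ≥0, ∀ t ∈ Icc 0 T, LipschitzWith L (w t))
    (hcont : ∀ x, ContinuousOn (fun t => w t x) (Ici 0))
    (hB : ∀ T : ℝ, ∃ B : ℝ≥0, ∀ t ∈ Icc 0 T, ∀ x, ‖w t x‖ ≤ B) (x : E) :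
    ∃ z, z 0 = x ∧ IsIntegralCurveOn z w (Ici 0) := by
  have hlocal : ∀ T, ∃ z, 0 ≤ T → z 0 = x ∧ IsIntegralCurveOn z w (Icc 0 T) := by
    intro T
    obtain ⟨L, hL⟩ := hL T
    obtain ⟨B, hB⟩ := hB T
    by_cases hT : 0 ≤ T
    · obtain ⟨z, hz⟩ := exists_isIntegralCurveOn_Icc hT hL
        (fun x => (hcont x).mono Icc_subset_Ici_self) hB x
      exact ⟨z, fun _ => hz⟩
    · exact ⟨0, fun h => absurd h hT⟩
  choose Z hZ using hlocal
  have agree : ∀ {S T}, 0 ≤ S → S ≤ T → EqOn (Z S) (Z T) (Icc 0 S) := by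
    intro S T hS hST
    obtain ⟨L, hL⟩ := hL S
    exact eqOn_Icc_of_isIntegralCurveOn (hZ S hS).2
      ((hZ T (hS.trans hST)).2.mono (Icc_subset_Icc_right hST))
      (fun t ht => hL t (Ico_subset_Icc_self ht)) ((hZ S hS).1.trans (hZ T (hS.trans hST)).1.symm)
  exact ⟨fun t => Z t t, (hZ 0 le_rfl).1, isIntegralCurveOn_Ici_of_eqOn_Icc
    (fun T _ t ht => agree ht.1 ht.2 (right_mem_Icc.2 ht.1)) fun T hT => (hZ T hT).2⟩

theorem of_forall_small_step {P : ℝ → Prop} {T δ : ℝ} (hδ : 0 < δ) (hzero : P 0)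
    (hstep : ∀ a b, 0 ≤ a → a ≤ b → b ≤ T → b - a ≤ δ → P a → P b) {t : ℝ} (ht : t ∈ Icc 0 T) :
    P t := by
  have hind : ∀ k : ℕ, ∀ t ∈ Icc 0 T, t ≤ k * δ → P t := by
    intro k
    induction k with
    | zero =>
      intro t ht htk
      rwa [le_antisymm (by simpa using htk) ht.1]
    | succ k ih =>
      intro t ht htk
      push_cast at htk
      refine hstep (max (t - δ) 0) t (le_max_right _ _) (max_le (by linarith) ht.1) ht.2
        (by linarith [le_max_left (t - δ) 0]) (ih _ ⟨le_max_right _ _, ?_⟩ ?_)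
      · exact max_le (by linarith [ht.2]) (ht.1.trans ht.2)
      · exact max_le (by linarith) (by positivity)
  obtain ⟨k, hk⟩ := exists_nat_ge (t / δ)
  exact hind k t ht ((div_le_iff₀ hδ).1 hk)

variable [FiniteDimensional ℝ E] [MeasurableSpace E] [BorelSpace E] {μ : Measure E}
  [μ.IsAddHaarMeasure] {Z : E → ℝ → E}

theorem isOrientedBilipschitz_flow_of_step (hab : a ≤ b) (hsmall : L * (b - a) ≤ 1 / 4)
    (hZ : ∀ y, IsIntegralCurveOn (Z y) w (Icc a b)) (hL : ∀ t ∈ Ico a b, LipschitzWith L (w t))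
    (ha : IsOrientedBilipschitz μ (fun y => Z y a)) :
    IsOrientedBilipschitz μ (fun y => Z y b) := by
  obtain ⟨g, hleft, hright⟩ := Function.bijective_iff_has_inverse.1 ha.bijective
  have exp_le_two : Real.exp (L * (b - a)) ≤ 2 := by
    rw [← Real.le_log_iff_exp_le two_pos]
    linarith [Real.log_two_gt_d9]
  have near_id : LipschitzWith (1 / 2) (fun x => Z (g x) b - x) := by
    refine LipschitzWith.of_dist_le_mul fun x x' => ?_
    have hdisp := norm_sub_sub_sub_le_of_isIntegralCurveOn hab (hZ (g x)) (hZ (g x')) hL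
    rw [show Z (g x) a = x from hright x, show Z (g x') a = x' from hright x'] at hdisp
    rw [dist_eq_norm, dist_eq_norm, sub_sub_sub_comm]
    refine hdisp.trans ?_
    gcongr
    have : 0 ≤ L * (b - a) := mul_nonneg L.2 (sub_nonneg.2 hab)
    push_cast
    nlinarith
  have step : IsOrientedBilipschitz μ (fun x => Z (g x) b) :=
    .of_lipschitzWith_sub_id (by norm_num) near_id
  convert! step.comp ha using 2 with y
  exact congrArg (Z · b) (hleft y).symm

theorem isOrientedBilipschitz_flow (hZ0 : ∀ y, Z y 0 = y)
    (hZ : ∀ y, IsIntegralCurveOn (Z y) w (Ici 0)) {T : ℝ} (hT : 0 ≤ T)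
    (hL : ∀ t ∈ Icc 0 T, LipschitzWith L (w t)) : IsOrientedBilipschitz μ (fun y => Z y T) := by
  refine of_forall_small_step (P := fun t => IsOrientedBilipschitz μ (Z · t))
    (δ := 1 / (4 * (L + 1))) (by positivity) ?_ ?_ (right_mem_Icc.2 hT)
  · simp only [hZ0]
    exact .id μ
  · intro a b ha hab hb hsmall
    refine isOrientedBilipschitz_flow_of_step hab ?_
      (fun y => (hZ y).mono fun t ht => ha.trans ht.1)
      (fun t ht => hL t ⟨ha.trans ht.1, ht.2.le.trans hb⟩)
    calc L * (b - a) ≤ (L + 1) * (1 / (4 * (L + 1))) := by gcongr; linarith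
      _ = 1 / 4 := by field_simp

end OrdinaryDifferentialEquations

section LogIntegralExp

theorem uniformConvexOn_log_integral_exp {E Ω : Type*} [NormedAddCommGroup E] [NormedSpace ℝ E]
    [MeasurableSpace Ω] {μ : Measure Ω} {m : ℝ → ℝ} {c : E → Ω → ℝ}
    (hc : ∀ ω, UniformConvexOn univ m (fun x => c x ω))
    (hint : ∀ x, Integrable (fun ω => Real.exp (c x ω)) μ)
    (hpos : ∀ x, 0 < ∫ ω, Real.exp (c x ω) ∂μ) :
    UniformConvexOn univ m (fun x => Real.log (∫ ω, Real.exp (c x ω) ∂μ)) := by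
  refine ⟨convex_univ, fun a _ b _ p q hp hq hpq => ?_⟩
  set A := Real.log (∫ ω, Real.exp (c a ω) ∂μ)
  set B := Real.log (∫ ω, Real.exp (c b ω) ∂μ)
  set D := p • A + q • B - p * q * m ‖a - b‖
  have exp_A : Real.exp A = ∫ ω, Real.exp (c a ω) ∂μ := Real.exp_log (hpos a)
  have exp_B : Real.exp B = ∫ ω, Real.exp (c b ω) ∂μ := Real.exp_log (hpos b)
  -- Normalising both integrands to have integral one reduces Hölder's inequality to Young's.
  have young (ω) : Real.exp (c (p • a + q • b) ω) ≤ Real.exp D *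
      (p * (Real.exp (-A) * Real.exp (c a ω)) + q * (Real.exp (-B) * Real.exp (c b ω))) := by
    have hcω := (hc ω).2 (mem_univ a) (mem_univ b) hp hq hpq
    have hexp := convexOn_exp.2 (mem_univ (-A + c a ω)) (mem_univ (-B + c b ω)) hp hq hpq
    simp only [smul_eq_mul] at hcω hexp
    rw [← Real.exp_add, ← Real.exp_add]
    calc Real.exp (c (p • a + q • b) ω)
        ≤ Real.exp (D + (p * (-A + c a ω) + q * (-B + c b ω))) := by
          rw [Real.exp_le_exp]; simp only [D, smul_eq_mul]; linarith
      _ ≤ _ := by rw [Real.exp_add]; gcongr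
  have hia := ((hint a).const_mul (Real.exp (-A))).const_mul p
  have hib := ((hint b).const_mul (Real.exp (-B))).const_mul q
  refine (Real.log_le_iff_le_exp (hpos _)).2 ?_
  calc ∫ ω, Real.exp (c (p • a + q • b) ω) ∂μ
      ≤ Real.exp D * (p * (Real.exp (-A) * Real.exp A) + q * (Real.exp (-B) * Real.exp B)) := by
        refine (integral_mono (hint _) ((hia.add hib).const_mul (Real.exp D)) young).trans_eq ?_
        rw [integral_const_mul, integral_add' hia hib, integral_const_mul, integral_const_mul,
          integral_const_mul, integral_const_mul, exp_A, exp_B]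
    _ = Real.exp D := by
        rw [← Real.exp_add, ← Real.exp_add, neg_add_cancel, neg_add_cancel, Real.exp_zero, mul_one,
          mul_one, hpq, mul_one]

theorem abs_exp_sub_exp_le (a b : ℝ) :
    |Real.exp a - Real.exp b| ≤ |a - b| * (Real.exp a + Real.exp b) := by
  wlog hab : b ≤ a generalizing a b
  · rw [abs_sub_comm, abs_sub_comm a, add_comm]
    exact this b a (le_of_not_ge hab)
  have hexp : Real.exp b = Real.exp (b - a) * Real.exp a := by rw [← Real.exp_add, sub_add_cancel]
  rw [abs_of_nonneg (sub_nonneg.2 (Real.exp_le_exp.2 hab)), abs_of_nonneg (sub_nonneg.2 hab)]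
  nlinarith [Real.add_one_le_exp (b - a), Real.exp_pos a, Real.exp_pos b]

end LogIntegralExp

section GaussianIntegrability

variable {V : Type*} [NormedAddCommGroup V] [InnerProductSpace ℝ V] [FiniteDimensional ℝ V]
  [MeasurableSpace V] [BorelSpace V]

theorem integrable_exp_neg_mul_sq_norm {b : ℝ} (hb : 0 < b) :
    Integrable (fun w : V => Real.exp (-b * ‖w‖ ^ 2)) := by
  have complex_integrable := (GaussianFourier.integrable_cexp_neg_mul_sq_norm_add (V := V) (b := b)
    (by simpa using hb) 0 0).norm
  refine complex_integrable.congr (Eventually.of_forall fun w => ?_)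
  simp only [Complex.norm_exp]
  congr 1
  simp [← Complex.ofReal_pow, ← Complex.ofReal_neg, ← Complex.ofReal_mul]

theorem integrable_exp_neg_mul_sq_norm_add {b : ℝ} (hb : 0 < b) (c : ℝ) :
    Integrable (fun w : V => Real.exp (-b * ‖w‖ ^ 2 + c * ‖w‖)) := by
  refine ((integrable_exp_neg_mul_sq_norm (V := V) (half_pos hb)).const_mul
    (Real.exp (c ^ 2 / (2 * b)))).mono' (by fun_prop) (Eventually.of_forall fun w => ?_)
  rw [Real.norm_eq_abs, Real.abs_exp, ← Real.exp_add, Real.exp_le_exp]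
  have complete_square : c ^ 2 / (2 * b) + -(b / 2) * ‖w‖ ^ 2 - (-b * ‖w‖ ^ 2 + c * ‖w‖)
      = (b * ‖w‖ - c) ^ 2 / (2 * b) := by field_simp; ring
  have : 0 ≤ (b * ‖w‖ - c) ^ 2 / (2 * b) := by positivity
  linarith

theorem integrable_norm_mul_exp_neg_mul_sq_norm_add {b : ℝ} (hb : 0 < b) (c : ℝ) :
    Integrable (fun w : V => ‖w‖ * Real.exp (-b * ‖w‖ ^ 2 + c * ‖w‖)) := by
  refine (integrable_exp_neg_mul_sq_norm_add (V := V) hb (c + 1)).mono' (by fun_prop)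
    (Eventually.of_forall fun w => ?_)
  rw [Real.norm_eq_abs, abs_of_nonneg (by positivity)]
  calc ‖w‖ * Real.exp (-b * ‖w‖ ^ 2 + c * ‖w‖)
      ≤ Real.exp ‖w‖ * Real.exp (-b * ‖w‖ ^ 2 + c * ‖w‖) := by
        gcongr; linarith [Real.add_one_le_exp ‖w‖]
    _ = _ := by rw [← Real.exp_add]; ring_nf

theorem hasGradientAt_integral_exp_inner {μ : Measure V} {f : V → ℝ} (hf : Integrable f μ)
    (hmoment : Integrable (fun w => ‖w‖ * Real.exp ‖w‖ * f w) μ) :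
    HasGradientAt (fun h => ∫ w, Real.exp (inner ℝ w h) * f w ∂μ) (∫ w, f w • w ∂μ) 0 := by
  have norm_le (w h : V) (hh : h ∈ Metric.ball 0 1) :
      ‖(Real.exp (inner ℝ w h) * f w) • innerSL ℝ w‖ ≤ ‖‖w‖ * Real.exp ‖w‖ * f w‖ := by
    have hinner : inner ℝ w h ≤ ‖w‖ := (real_inner_le_norm w h).trans
      (mul_le_of_le_one_right (norm_nonneg w) (mem_ball_zero_iff.1 hh).le)
    rw [norm_smul, innerSL_apply_norm, norm_mul, norm_mul, norm_mul, norm_norm, Real.norm_eq_abs,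
      Real.norm_eq_abs, Real.norm_eq_abs, Real.abs_exp, Real.abs_exp]
    calc Real.exp (inner ℝ w h) * |f w| * ‖w‖ ≤ Real.exp ‖w‖ * |f w| * ‖w‖ := by gcongr
      _ = ‖w‖ * Real.exp ‖w‖ * |f w| := by ring
  have hfm := hf.aestronglyMeasurable
  have hderiv := hasFDerivAt_integral_of_dominated_of_fderiv_le (μ := μ)
    (F := fun h w => Real.exp (inner ℝ w h) * f w)
    (F' := fun h w => (Real.exp (inner ℝ w h) * f w) • innerSL ℝ w)
    (Metric.ball_mem_nhds 0 one_pos) (Eventually.of_forall fun h => by fun_prop)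
    (by simpa using hf) (by fun_prop) (Eventually.of_forall norm_le) hmoment.norm
    (Eventually.of_forall fun w h _ => by
      have := ((innerSL ℝ w).hasFDerivAt (x := h)).exp.mul_const (f w)
      simpa [smul_smul, mul_comm] using this)
  have hint : Integrable (fun w => f w • w) μ := by
    refine hmoment.mono (by fun_prop) (Eventually.of_forall fun w => ?_)
    simpa [norm_smul, Real.abs_exp, abs_mul] using norm_le w 0 (by simp)
  rw [hasGradientAt_iff_hasFDerivAt]
  convert! hderiv using 1
  have integral_comm : ∫ w, f w • innerSL ℝ w ∂μ = innerSL ℝ (∫ w, f w • w ∂μ) := by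
    simpa using ContinuousLinearMap.integral_comp_comm (innerSL ℝ : V →L[ℝ] V →L[ℝ] ℝ) hint
  simp only [inner_zero_right, Real.exp_zero, one_mul]
  exact integral_comm.symm

end GaussianIntegrability

section GaussianTransform

variable {V : Type*} [NormedAddCommGroup V] [InnerProductSpace ℝ V] {ψ : V → ℝ} {k : ℝ≥0}

/-- The unnormalised Gibbs weight of `w`, in the variable `w = (y - x) / σ` that keeps the heat
kernel regular as its variance `σ ^ 2` vanishes. For `ψ = -φ / ε` and `σ ^ 2 = ε * t` it is the
integrand of the Cole-Hopf formula. -/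
noncomputable def gaussWeight (ψ : V → ℝ) (σ : ℝ) (x w : V) : ℝ :=
  Real.exp (-(1 / 2) * ‖w‖ ^ 2 + ψ (x + σ • w))

theorem gaussWeight_pos (ψ : V → ℝ) (σ : ℝ) (x w : V) : 0 < gaussWeight ψ σ x w :=
  Real.exp_pos _

theorem norm_gaussWeight_smul (ψ : V → ℝ) (σ : ℝ) (x w : V) :
    ‖gaussWeight ψ σ x w • w‖ = ‖w‖ * gaussWeight ψ σ x w := by
  rw [norm_smul, Real.norm_of_nonneg (gaussWeight_pos ψ σ x w).le, mul_comm]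

theorem abs_comp_add_smul_sub_le (hψ : LipschitzWith k ψ) {σ S : ℝ} (hσ : |σ| ≤ S) (x w : V) :
    |ψ (x + σ • w) - ψ x| ≤ k * S * ‖w‖ := by
  have hlip := hψ.norm_sub_le (x + σ • w) x
  rw [add_sub_cancel_left, norm_smul, Real.norm_eq_abs, Real.norm_eq_abs, ← mul_assoc] at hlip
  exact hlip.trans (by gcongr)

theorem gaussWeight_le (hψ : LipschitzWith k ψ) {σ S : ℝ} (hσ : |σ| ≤ S) (x w : V) :
    gaussWeight ψ σ x w ≤ Real.exp (ψ x) * Real.exp (-(1 / 2) * ‖w‖ ^ 2 + k * S * ‖w‖) := by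
  rw [gaussWeight, ← Real.exp_add, Real.exp_le_exp]
  linarith [(abs_le.1 (abs_comp_add_smul_sub_le hψ hσ x w)).2]

theorem le_gaussWeight (hψ : LipschitzWith k ψ) {σ S : ℝ} (hσ : |σ| ≤ S) (x w : V) :
    Real.exp (ψ x) * Real.exp (-(1 / 2) * ‖w‖ ^ 2 + -(k * S) * ‖w‖) ≤ gaussWeight ψ σ x w := by
  rw [gaussWeight, ← Real.exp_add, Real.exp_le_exp]
  linarith [(abs_le.1 (abs_comp_add_smul_sub_le hψ hσ x w)).1]

theorem abs_gaussWeight_sub_le (hψ : LipschitzWith k ψ) (σ : ℝ) (x x' w : V) :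
    |gaussWeight ψ σ x w - gaussWeight ψ σ x' w| ≤
      k * ‖x - x'‖ * (gaussWeight ψ σ x w + gaussWeight ψ σ x' w) := by
  refine (abs_exp_sub_exp_le _ _).trans (mul_le_mul_of_nonneg_right ?_
    (add_nonneg (gaussWeight_pos ψ σ x w).le (gaussWeight_pos ψ σ x' w).le))
  have hlip := hψ.norm_sub_le (x + σ • w) (x' + σ • w)
  rw [add_sub_add_right_eq_sub, Real.norm_eq_abs] at hlip
  rwa [add_sub_add_left_eq_sub]

variable [MeasurableSpace V] [BorelSpace V]

theorem measurable_gaussWeight (hψ : LipschitzWith k ψ) (σ : ℝ) (x : V) :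
    Measurable (gaussWeight ψ σ x) := by
  have hc := hψ.continuous
  unfold gaussWeight
  fun_prop

variable [FiniteDimensional ℝ V]

/-- The integral of `gaussWeight`: the heat semigroup applied to `exp ∘ ψ`, up to the factor
`(2 * π) ^ (dim V / 2)`. -/
noncomputable def gaussMass (ψ : V → ℝ) (σ : ℝ) (x : V) : ℝ :=
  ∫ w, gaussWeight ψ σ x w

/-- The first moment of `gaussWeight`. -/
noncomputable def gaussMoment (ψ : V → ℝ) (σ : ℝ) (x : V) : V :=
  ∫ w, gaussWeight ψ σ x w • w

/-- The mean of the Gibbs measure with weight `gaussWeight`. It is, up to scaling, the logarithmic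
gradient of `gaussMass`, and it remains regular at `σ = 0`. -/
noncomputable def gaussMean (ψ : V → ℝ) (σ : ℝ) (x : V) : V :=
  (gaussMass ψ σ x)⁻¹ • gaussMoment ψ σ x

theorem integrable_gaussWeight (hψ : LipschitzWith k ψ) (σ : ℝ) (x : V) :
    Integrable (gaussWeight ψ σ x) := by
  refine ((integrable_exp_neg_mul_sq_norm_add one_half_pos (k * |σ|)).const_mul
    (Real.exp (ψ x))).mono' (measurable_gaussWeight hψ σ x).aestronglyMeasurable
    (Eventually.of_forall fun w => ?_)
  rw [Real.norm_of_nonneg (gaussWeight_pos ψ σ x w).le]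
  exact gaussWeight_le hψ le_rfl x w

theorem integrable_norm_mul_exp_norm_mul_gaussWeight (hψ : LipschitzWith k ψ) (σ : ℝ) (x : V) :
    Integrable (fun w => ‖w‖ * Real.exp ‖w‖ * gaussWeight ψ σ x w) := by
  have hm := measurable_gaussWeight hψ σ x
  refine ((integrable_norm_mul_exp_neg_mul_sq_norm_add one_half_pos (k * |σ| + 1)).const_mul
    (Real.exp (ψ x))).mono' (by fun_prop) (Eventually.of_forall fun w => ?_)
  have hpos := gaussWeight_pos ψ σ x w
  rw [Real.norm_of_nonneg (by positivity)]
  calc ‖w‖ * Real.exp ‖w‖ * gaussWeight ψ σ x w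
      ≤ ‖w‖ * Real.exp ‖w‖ *
          (Real.exp (ψ x) * Real.exp (-(1 / 2) * ‖w‖ ^ 2 + k * |σ| * ‖w‖)) := by
        gcongr; exact gaussWeight_le hψ le_rfl x w
    _ = Real.exp (ψ x) *
          (‖w‖ * Real.exp (-(1 / 2) * ‖w‖ ^ 2 + (k * |σ| + 1) * ‖w‖)) := by
        rw [add_mul, one_mul, ← add_assoc, Real.exp_add _ ‖w‖]; ring

theorem integrable_norm_mul_gaussWeight (hψ : LipschitzWith k ψ) (σ : ℝ) (x : V) :
    Integrable (fun w => ‖w‖ * gaussWeight ψ σ x w) := by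
  have hm := measurable_gaussWeight hψ σ x
  refine (integrable_norm_mul_exp_norm_mul_gaussWeight hψ σ x).mono' (by fun_prop)
    (Eventually.of_forall fun w => ?_)
  have hpos := gaussWeight_pos ψ σ x w
  rw [Real.norm_of_nonneg (by positivity)]
  gcongr
  exact le_mul_of_one_le_right (norm_nonneg w) (Real.one_le_exp (norm_nonneg w))

theorem integrable_gaussWeight_smul (hψ : LipschitzWith k ψ) (σ : ℝ) (x : V) :
    Integrable (fun w => gaussWeight ψ σ x w • w) :=
  (integrable_norm_mul_gaussWeight hψ σ x).mono'
    ((measurable_gaussWeight hψ σ x).smul measurable_id).aestronglyMeasurable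
    (Eventually.of_forall fun w => (norm_gaussWeight_smul ψ σ x w).le)

theorem gaussMass_pos (hψ : LipschitzWith k ψ) (σ : ℝ) (x : V) : 0 < gaussMass ψ σ x :=
  integral_exp_pos (integrable_gaussWeight hψ σ x)

theorem exists_integral_norm_mul_gaussWeight_le (hψ : LipschitzWith k ψ) (S : ℝ) :
    ∃ M : ℝ≥0, ∀ σ : ℝ, |σ| ≤ S → ∀ x,
      ∫ w, ‖w‖ * gaussWeight ψ σ x w ≤ M * gaussMass ψ σ x := by
  set lower : V → ℝ := fun w => Real.exp (-(1 / 2) * ‖w‖ ^ 2 + -(k * S) * ‖w‖)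
  set upper : V → ℝ := fun w => ‖w‖ * Real.exp (-(1 / 2) * ‖w‖ ^ 2 + k * S * ‖w‖)
  have lower_integrable : Integrable lower := integrable_exp_neg_mul_sq_norm_add one_half_pos _
  have upper_integrable : Integrable upper :=
    integrable_norm_mul_exp_neg_mul_sq_norm_add one_half_pos _
  have lower_pos : 0 < ∫ w, lower w := integral_exp_pos lower_integrable
  have upper_nonneg : 0 ≤ ∫ w, upper w := integral_nonneg fun w => by positivity
  refine ⟨((∫ w, upper w) / ∫ w, lower w).toNNReal, fun σ hσ x => ?_⟩
  rw [Real.coe_toNNReal _ (div_nonneg upper_nonneg lower_pos.le)]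
  calc ∫ w, ‖w‖ * gaussWeight ψ σ x w ≤ ∫ w, Real.exp (ψ x) * upper w := by
        refine integral_mono (integrable_norm_mul_gaussWeight hψ σ x)
          (upper_integrable.const_mul _) fun w => ?_
        simp only [upper]
        rw [mul_left_comm]
        gcongr
        exact gaussWeight_le hψ hσ x w
    _ = (∫ w, upper w) / (∫ w, lower w) * ∫ w, Real.exp (ψ x) * lower w := by
        rw [integral_const_mul, integral_const_mul]; field_simp
    _ ≤ (∫ w, upper w) / (∫ w, lower w) * gaussMass ψ σ x := by
        gcongr
        exact integral_mono (lower_integrable.const_mul _) (integrable_gaussWeight hψ σ x)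
          fun w => le_gaussWeight hψ hσ x w

theorem norm_gaussMoment_le (ψ : V → ℝ) (σ : ℝ) (x : V) :
    ‖gaussMoment ψ σ x‖ ≤ ∫ w, ‖w‖ * gaussWeight ψ σ x w :=
  (norm_integral_le_integral_norm _).trans_eq (by simp_rw [norm_gaussWeight_smul])

theorem norm_gaussMean_le (hψ : LipschitzWith k ψ) {σ M : ℝ} {x : V}
    (hM : ∫ w, ‖w‖ * gaussWeight ψ σ x w ≤ M * gaussMass ψ σ x) : ‖gaussMean ψ σ x‖ ≤ M := by
  have hpos := gaussMass_pos hψ σ x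
  rw [gaussMean, norm_smul, norm_inv, Real.norm_of_nonneg hpos.le, inv_mul_le_iff₀ hpos, mul_comm]
  exact (norm_gaussMoment_le ψ σ x).trans hM

theorem abs_gaussMass_sub_le (hψ : LipschitzWith k ψ) (σ : ℝ) (x x' : V) :
    |gaussMass ψ σ x - gaussMass ψ σ x'| ≤
      k * ‖x - x'‖ * (gaussMass ψ σ x + gaussMass ψ σ x') := by
  have hx := integrable_gaussWeight hψ σ x
  have hx' := integrable_gaussWeight hψ σ x'
  simp only [gaussMass]
  rw [← integral_sub hx hx', ← integral_add hx hx', ← integral_const_mul, ← Real.norm_eq_abs]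
  exact norm_integral_le_of_norm_le ((hx.add hx').const_mul _)
    (Eventually.of_forall fun w => abs_gaussWeight_sub_le hψ σ x x' w)

theorem norm_gaussMoment_sub_le (hψ : LipschitzWith k ψ) (σ : ℝ) (x x' : V) :
    ‖gaussMoment ψ σ x - gaussMoment ψ σ x'‖ ≤ k * ‖x - x'‖ *
      ((∫ w, ‖w‖ * gaussWeight ψ σ x w) + ∫ w, ‖w‖ * gaussWeight ψ σ x' w) := by
  have hx := integrable_norm_mul_gaussWeight hψ σ x
  have hx' := integrable_norm_mul_gaussWeight hψ σ x'
  rw [gaussMoment, gaussMoment, ← integral_sub (integrable_gaussWeight_smul hψ σ x)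
    (integrable_gaussWeight_smul hψ σ x'), ← integral_add hx hx', ← integral_const_mul]
  refine norm_integral_le_of_norm_le ((hx.add hx').const_mul _) (Eventually.of_forall fun w => ?_)
  rw [← sub_smul, norm_smul, Real.norm_eq_abs, mul_comm, ← mul_add, mul_left_comm]
  gcongr
  exact abs_gaussWeight_sub_le hψ σ x x' w

theorem norm_inv_smul_sub_inv_smul_le {E : Type*} [NormedAddCommGroup E] [NormedSpace ℝ E]
    {a b r M : ℝ} {p q : E} (ha : 0 < a) (hb : 0 < b) (hab : |a - b| ≤ r * (a + b))
    (hpq : ‖p - q‖ ≤ r * (M * a + M * b)) (hp : ‖a⁻¹ • p‖ ≤ M) (hq : ‖b⁻¹ • q‖ ≤ M) :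
    ‖a⁻¹ • p - b⁻¹ • q‖ ≤ 4 * M * r := by
  have symmetrised :
      (a + b) • (a⁻¹ • p - b⁻¹ • q) = (2 : ℝ) • (p - q) - (a - b) • (a⁻¹ • p + b⁻¹ • q) := by
    match_scalars <;> field_simp <;> ring
  refine le_of_mul_le_mul_left ?_ (add_pos ha hb)
  calc (a + b) * ‖a⁻¹ • p - b⁻¹ • q‖
      = ‖(2 : ℝ) • (p - q) - (a - b) • (a⁻¹ • p + b⁻¹ • q)‖ := by
        rw [← symmetrised, norm_smul, Real.norm_of_nonneg (add_pos ha hb).le]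
    _ ≤ 2 * ‖p - q‖ + |a - b| * (‖a⁻¹ • p‖ + ‖b⁻¹ • q‖) := by
        refine (norm_sub_le _ _).trans ?_
        rw [norm_smul, norm_smul, Real.norm_two, Real.norm_eq_abs]
        gcongr
        exact norm_add_le _ _
    _ ≤ 2 * (r * (M * a + M * b)) + r * (a + b) * (M + M) := by
        gcongr
        exact (abs_nonneg _).trans hab
    _ = (a + b) * (4 * M * r) := by ring

theorem exists_lipschitzWith_gaussMean (hψ : LipschitzWith k ψ) (S : ℝ) :
    ∃ L : ℝ≥0, ∀ σ : ℝ, |σ| ≤ S → LipschitzWith L (gaussMean ψ σ) := by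
  obtain ⟨M, hM⟩ := exists_integral_norm_mul_gaussWeight_le hψ S
  refine ⟨4 * M * k, fun σ hσ => LipschitzWith.of_dist_le_mul fun x x' => ?_⟩
  rw [dist_eq_norm, dist_eq_norm, NNReal.coe_mul, mul_assoc]
  refine norm_inv_smul_sub_inv_smul_le (gaussMass_pos hψ σ x) (gaussMass_pos hψ σ x')
    (abs_gaussMass_sub_le hψ σ x x') ((norm_gaussMoment_sub_le hψ σ x x').trans ?_)
    (norm_gaussMean_le hψ (hM σ hσ x)) (norm_gaussMean_le hψ (hM σ hσ x'))
  gcongr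
  exacts [hM σ hσ x, hM σ hσ x']

theorem continuous_gaussMass (hψ : LipschitzWith k ψ) (x : V) :
    Continuous (fun σ => gaussMass ψ σ x) := by
  have hc := hψ.continuous
  refine continuous_iff_continuousAt.2 fun σ₀ => ?_
  have near : ∀ᶠ σ in 𝓝 σ₀, |σ| ≤ |σ₀| + 1 :=
    (continuous_abs.tendsto σ₀).eventually_le_const (lt_add_one _)
  refine continuousAt_of_dominated (Eventually.of_forall fun σ =>
      (measurable_gaussWeight hψ σ x).aestronglyMeasurable)
    (near.mono fun σ hσ => Eventually.of_forall fun w => ?_)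
    ((integrable_exp_neg_mul_sq_norm_add (V := V) one_half_pos (k * (|σ₀| + 1))).const_mul
      (Real.exp (ψ x))) (Eventually.of_forall fun w => by unfold gaussWeight; fun_prop)
  rw [Real.norm_of_nonneg (gaussWeight_pos ψ σ x w).le]
  exact gaussWeight_le hψ hσ x w

theorem continuous_gaussMoment (hψ : LipschitzWith k ψ) (x : V) :
    Continuous (fun σ => gaussMoment ψ σ x) := by
  have hc := hψ.continuous
  refine continuous_iff_continuousAt.2 fun σ₀ => ?_
  have near : ∀ᶠ σ in 𝓝 σ₀, |σ| ≤ |σ₀| + 1 :=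
    (continuous_abs.tendsto σ₀).eventually_le_const (lt_add_one _)
  refine continuousAt_of_dominated (Eventually.of_forall fun σ =>
      (integrable_gaussWeight_smul hψ σ x).aestronglyMeasurable)
    (near.mono fun σ hσ => Eventually.of_forall fun w => ?_)
    ((integrable_norm_mul_exp_neg_mul_sq_norm_add (V := V) one_half_pos
      (k * (|σ₀| + 1))).const_mul (Real.exp (ψ x)))
    (Eventually.of_forall fun w => by unfold gaussWeight; fun_prop)
  rw [norm_gaussWeight_smul, mul_left_comm]
  gcongr
  exact gaussWeight_le hψ hσ x w

theorem continuous_gaussMean (hψ : LipschitzWith k ψ) (x : V) :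
    Continuous (fun σ => gaussMean ψ σ x) :=
  ((continuous_gaussMass hψ x).inv₀ fun σ => (gaussMass_pos hψ σ x).ne').smul
    (continuous_gaussMoment hψ x)

theorem lipschitzWith_log_gaussMass (hψ : LipschitzWith k ψ) (σ : ℝ) :
    LipschitzWith k (fun x => Real.log (gaussMass ψ σ x)) := by
  refine LipschitzWith.of_le_add_mul k fun x x' => ?_
  have weight_le (w : V) :
      gaussWeight ψ σ x w ≤ Real.exp (k * dist x x') * gaussWeight ψ σ x' w := by
    rw [gaussWeight, gaussWeight, ← Real.exp_add, Real.exp_le_exp]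
    have hlip := hψ.dist_le_mul (x + σ • w) (x' + σ • w)
    rw [dist_add_right, Real.dist_eq] at hlip
    linarith [(abs_le.1 hlip).2]
  rw [Real.log_le_iff_le_exp (gaussMass_pos hψ σ x), Real.exp_add,
    Real.exp_log (gaussMass_pos hψ σ x'), mul_comm, gaussMass, gaussMass, ← integral_const_mul]
  exact integral_mono (integrable_gaussWeight hψ σ x)
    ((integrable_gaussWeight hψ σ x').const_mul _) weight_le

theorem strongConvexOn_log_gaussMass (hψ : LipschitzWith k ψ) {m : ℝ}
    (hconv : StrongConvexOn univ m ψ) (σ : ℝ) :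
    StrongConvexOn univ m (fun x => Real.log (gaussMass ψ σ x)) := by
  refine uniformConvexOn_log_integral_exp (fun w => ⟨convex_univ, fun a _ b _ p q hp hq hpq => ?_⟩)
    (integrable_gaussWeight hψ σ) (gaussMass_pos hψ σ)
  have hψw := hconv.2 (mem_univ (a + σ • w)) (mem_univ (b + σ • w)) hp hq hpq
  rw [smul_add, smul_add, add_add_add_comm, ← add_smul, hpq, one_smul,
    add_sub_add_right_eq_sub] at hψw
  simp only [smul_eq_mul] at hψw ⊢
  linear_combination hψw + (1 / 2) * ‖w‖ ^ 2 * hpq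

theorem gaussMass_add_smul (ψ : V → ℝ) (σ : ℝ) (x h : V) :
    gaussMass ψ σ (x + σ • h) =
      Real.exp (-(1 / 2) * ‖h‖ ^ 2) * ∫ w, Real.exp (inner ℝ w h) * gaussWeight ψ σ x w := by
  rw [gaussMass, ← integral_sub_right_eq_self _ h, ← integral_const_mul]
  congr with w
  rw [gaussWeight, gaussWeight, ← Real.exp_add, ← Real.exp_add, norm_sub_sq_real, smul_sub,
    add_add_sub_cancel]
  ring_nf

theorem hasGradientAt_gaussMass (hψ : LipschitzWith k ψ) {σ : ℝ} (hσ : σ ≠ 0) (x : V) :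
    HasGradientAt (gaussMass ψ σ) (σ⁻¹ • gaussMoment ψ σ x) x := by
  have hnorm : HasFDerivAt (fun h : V => Real.exp (-(1 / 2) * ‖h‖ ^ 2)) (0 : V →L[ℝ] ℝ) 0 := by
    simpa using (((hasFDerivAt_id (0 : V)).norm_sq).const_mul (-(1 / 2))).exp
  have hint := (hasGradientAt_integral_exp_inner (integrable_gaussWeight hψ σ x)
    (integrable_norm_mul_exp_norm_mul_gaussWeight hψ σ x)).hasFDerivAt
  have hshift : HasFDerivAt (fun x' => σ⁻¹ • (x' - x)) (σ⁻¹ • ContinuousLinearMap.id ℝ V) x :=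
    ((hasFDerivAt_id x).sub_const x).const_smul σ⁻¹
  have hcomp := HasFDerivAt.comp (g := fun h => Real.exp (-(1 / 2) * ‖h‖ ^ 2) *
    ∫ w, Real.exp (inner ℝ w h) * gaussWeight ψ σ x w) x
    (by rw [sub_self, smul_zero]; exact hnorm.mul hint) hshift
  rw [hasGradientAt_iff_hasFDerivAt]
  convert! hcomp using 1
  · ext x'
    rw [Function.comp_apply, ← gaussMass_add_smul, smul_inv_smul₀ hσ, add_sub_cancel]
  · ext v
    simp [gaussMoment]

theorem hasGradientAt_log_gaussMass (hψ : LipschitzWith k ψ) {σ : ℝ} (hσ : σ ≠ 0) (x : V) :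
    HasGradientAt (fun x => Real.log (gaussMass ψ σ x)) (σ⁻¹ • gaussMean ψ σ x) x := by
  have hlog := (hasGradientAt_gaussMass hψ hσ x).hasFDerivAt.log (gaussMass_pos hψ σ x).ne'
  rw [hasGradientAt_iff_hasFDerivAt]
  convert! hlog using 1
  rw [gaussMean, smul_comm, map_smul]

end GaussianTransform

section LaplaceAsymptotics

variable {V : Type*} [NormedAddCommGroup V] [InnerProductSpace ℝ V] [FiniteDimensional ℝ V]
  [MeasurableSpace V] [BorelSpace V] {ψ : V → ℝ} {k : ℝ≥0}

theorem log_integral_exp_neg_half_mul_sq_norm :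
    Real.log (∫ w : V, Real.exp (-(1 / 2) * ‖w‖ ^ 2)) =
      Module.finrank ℝ V / 2 * Real.log (2 * Real.pi) := by
  rw [GaussianFourier.integral_rexp_neg_mul_sq_norm one_half_pos, Real.log_rpow (by positivity),
    div_div_eq_mul_div, div_one, mul_comm Real.pi]

theorem exp_mul_integral_le_integral_exp_mul {Ω : Type*} [MeasurableSpace Ω] {μ : Measure Ω}
    {f g : Ω → ℝ} {c : ℝ} (hg : ∀ ω, 0 ≤ g ω) (hg_int : Integrable g μ)
    (hfg : Integrable (fun ω => f ω * g ω) μ) (hexp : Integrable (fun ω => Real.exp (f ω) * g ω) μ)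
    (hc : ∫ ω, f ω * g ω ∂μ = c * ∫ ω, g ω ∂μ) :
    Real.exp c * ∫ ω, g ω ∂μ ≤ ∫ ω, Real.exp (f ω) * g ω ∂μ := by
  have tangent (ω) : Real.exp c * ((1 - c) * g ω + f ω * g ω) ≤ Real.exp (f ω) * g ω := by
    have hsplit : Real.exp (f ω) = Real.exp c * Real.exp (f ω - c) := by
      rw [← Real.exp_add, add_sub_cancel]
    rw [← add_mul, ← mul_assoc, hsplit]
    gcongr
    · exact hg ω
    · linarith [Real.add_one_le_exp (f ω - c)]
  calc Real.exp c * ∫ ω, g ω ∂μ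
      = ∫ ω, Real.exp c * ((1 - c) * g ω + f ω * g ω) ∂μ := by
        rw [integral_const_mul, integral_add (hg_int.const_mul _) hfg, integral_const_mul, hc]
        ring
    _ ≤ ∫ ω, Real.exp (f ω) * g ω ∂μ :=
        integral_mono (((hg_int.const_mul _).add hfg).const_mul _) hexp tangent

theorem integral_inner_mul_exp_neg_half_mul_sq_norm (p : V) :
    ∫ w : V, inner ℝ p w * Real.exp (-(1 / 2) * ‖w‖ ^ 2) = 0 := by
  have odd := integral_neg_eq_self
    (fun w : V => inner ℝ p w * Real.exp (-(1 / 2) * ‖w‖ ^ 2)) volume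
  simp_rw [norm_neg, inner_neg_right, neg_mul (inner ℝ p _), integral_neg] at odd
  linarith

theorem integrable_inner_mul_exp_neg_half_mul_sq_norm (p : V) :
    Integrable (fun w : V => inner ℝ p w * Real.exp (-(1 / 2) * ‖w‖ ^ 2)) := by
  have hnorm := integrable_norm_mul_exp_neg_mul_sq_norm_add (V := V) one_half_pos 0
  refine (hnorm.const_mul ‖p‖).mono' (by fun_prop) (Eventually.of_forall fun w => ?_)
  rw [norm_mul, Real.norm_eq_abs (Real.exp _), Real.abs_exp, zero_mul, add_zero, ← mul_assoc]
  gcongr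
  exact norm_inner_le_norm p w

theorem exp_mul_integral_le_gaussMass (hψ : LipschitzWith k ψ) {σ c : ℝ} (hσ : 0 ≤ σ) (x p : V)
    (hc : ∫ w : V, ‖w‖ * Real.exp (-(1 / 2) * ‖w‖ ^ 2) =
      c * ∫ w : V, Real.exp (-(1 / 2) * ‖w‖ ^ 2)) :
    Real.exp (-(1 / 2) * ‖p‖ ^ 2 + ψ (x + σ • p) - k * σ * c) *
      ∫ w : V, Real.exp (-(1 / 2) * ‖w‖ ^ 2) ≤ gaussMass ψ σ x := by
  set g : V → ℝ := fun w => Real.exp (-(1 / 2) * ‖w‖ ^ 2)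
  set E : ℝ := -(1 / 2) * ‖p‖ ^ 2 + ψ (x + σ • p)
  set f : V → ℝ := fun w => E - inner ℝ p w - k * σ * ‖w‖
  have g_int : Integrable g := integrable_exp_neg_mul_sq_norm one_half_pos
  have norm_int : Integrable (fun w => ‖w‖ * g w) := by
    simpa [g] using integrable_norm_mul_exp_neg_mul_sq_norm_add (V := V) one_half_pos 0
  have affine_int : Integrable (fun w => E * g w - inner ℝ p w * g w) :=
    (g_int.const_mul E).sub (integrable_inner_mul_exp_neg_half_mul_sq_norm p)
  have f_mul (w : V) : f w * g w = E * g w - inner ℝ p w * g w - k * σ * (‖w‖ * g w) := by ring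
  have exp_f_mul_le (w : V) : Real.exp (f w) * g w ≤ gaussWeight ψ σ x (p + w) := by
    have hlip := (abs_le.1 (abs_comp_add_smul_sub_le hψ (abs_of_nonneg hσ).le (x + σ • p) w)).1
    rw [gaussWeight, ← Real.exp_add, Real.exp_le_exp, norm_add_sq_real, smul_add, ← add_assoc]
    simp only [f, E]
    linarith
  have weight_int := (integrable_gaussWeight hψ σ x).comp_add_left p
  have exp_f_int : Integrable (fun w => Real.exp (f w) * g w) :=
    weight_int.mono' (by fun_prop) (Eventually.of_forall fun w => by
      rw [Real.norm_of_nonneg (by positivity)]; exact exp_f_mul_le w)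
  have f_mean : ∫ w, f w * g w = (E - k * σ * c) * ∫ w, g w := by
    simp_rw [f_mul]
    rw [integral_sub affine_int (norm_int.const_mul _), integral_sub (g_int.const_mul E)
      (integrable_inner_mul_exp_neg_half_mul_sq_norm p), integral_const_mul, integral_const_mul,
      hc, integral_inner_mul_exp_neg_half_mul_sq_norm]
    ring
  have f_int : Integrable (fun w => f w * g w) := by
    simp_rw [f_mul]
    exact affine_int.sub (norm_int.const_mul _)
  calc Real.exp (E - k * σ * c) * ∫ w, g w ≤ ∫ w, Real.exp (f w) * g w :=
        exp_mul_integral_le_integral_exp_mul (fun w => (Real.exp_pos _).le) g_int f_int exp_f_int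
          f_mean
    _ ≤ ∫ w, gaussWeight ψ σ x (p + w) := integral_mono exp_f_int weight_int exp_f_mul_le
    _ = gaussMass ψ σ x := integral_add_left_eq_self _ p

theorem exists_le_log_gaussMass (V : Type*) [NormedAddCommGroup V] [InnerProductSpace ℝ V]
    [FiniteDimensional ℝ V] [MeasurableSpace V] [BorelSpace V] :
    ∃ c : ℝ, 0 ≤ c ∧ ∀ (ψ : V → ℝ) (k : ℝ≥0), LipschitzWith k ψ → ∀ σ : ℝ, 0 ≤ σ → ∀ x p : V,
      -(1 / 2) * ‖p‖ ^ 2 + ψ (x + σ • p) - k * σ * c +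
        Module.finrank ℝ V / 2 * Real.log (2 * Real.pi) ≤ Real.log (gaussMass ψ σ x) := by
  have mass_pos : 0 < ∫ w : V, Real.exp (-(1 / 2) * ‖w‖ ^ 2) :=
    integral_exp_pos (integrable_exp_neg_mul_sq_norm one_half_pos)
  have moment_nonneg : 0 ≤ ∫ w : V, ‖w‖ * Real.exp (-(1 / 2) * ‖w‖ ^ 2) :=
    integral_nonneg fun w => by positivity
  refine ⟨_, div_nonneg moment_nonneg mass_pos.le, fun ψ k hψ σ hσ x p => ?_⟩
  rw [← log_integral_exp_neg_half_mul_sq_norm, Real.le_log_iff_exp_le (gaussMass_pos hψ σ x),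
    Real.exp_add, Real.exp_log mass_pos]
  exact exp_mul_integral_le_gaussMass hψ hσ x p (div_mul_cancel₀ _ mass_pos.ne').symm

theorem log_gaussMass_le (hψ : LipschitzWith k ψ) {σ : ℝ} {x : V} {A θ : ℝ} (hθ : 0 < θ)
    (h : ∀ w, -(1 / 2) * ‖w‖ ^ 2 + ψ (x + σ • w) ≤ A - θ * (‖w‖ ^ 2 / 4)) :
    Real.log (gaussMass ψ σ x) ≤
      A + Module.finrank ℝ V / 2 * (Real.log (2 / θ) + Real.log (2 * Real.pi)) := by
  have hb : 0 < θ / 4 := by positivity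
  have weight_le (w : V) :
      gaussWeight ψ σ x w ≤ Real.exp A * Real.exp (-(θ / 4) * ‖w‖ ^ 2) := by
    rw [gaussWeight, ← Real.exp_add, Real.exp_le_exp]
    linarith [h w]
  rw [Real.log_le_iff_le_exp (gaussMass_pos hψ σ x)]
  calc gaussMass ψ σ x ≤ ∫ w : V, Real.exp A * Real.exp (-(θ / 4) * ‖w‖ ^ 2) :=
        integral_mono (integrable_gaussWeight hψ σ x)
          ((integrable_exp_neg_mul_sq_norm hb).const_mul _) weight_le
    _ = Real.exp A * (2 / θ * (2 * Real.pi)) ^ ((Module.finrank ℝ V : ℝ) / 2) := by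
        rw [integral_const_mul, GaussianFourier.integral_rexp_neg_mul_sq_norm hb]
        congr 2
        field_simp
        norm_num
    _ = _ := by
        rw [Real.rpow_def_of_pos (by positivity), ← Real.exp_add,
          Real.log_mul (by positivity) (by positivity), mul_comm (_ / 2)]

end LaplaceAsymptotics

section HopfLax

variable {V : Type*} [NormedAddCommGroup V] {φ : V → ℝ} {K : ℝ≥0} {t θ : ℝ}

/-- The Hopf-Lax formula for the solution of `∂ₜ u + |∇u|² / 2 = 0` with initial value `φ`, the
limit of the Cole-Hopf solutions as the viscosity vanishes. -/
noncomputable def hopfLax (φ : V → ℝ) (t : ℝ) (x : V) : ℝ :=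
  ⨅ y, (‖x - y‖ ^ 2 / (2 * t) + φ y)

theorem add_sq_norm_sub_le (hK : LipschitzWith K φ) (ht : 0 < t) (x y : V) :
    φ x + (‖x - y‖ ^ 2 / (4 * t) - K ^ 2 * t) ≤ ‖x - y‖ ^ 2 / (2 * t) + φ y := by
  have hlip := (abs_le.1 (hK.norm_sub_le x y)).2
  have complete_square : ‖x - y‖ ^ 2 / (2 * t) + K ^ 2 * t - K * ‖x - y‖ - ‖x - y‖ ^ 2 / (4 * t) =
      (‖x - y‖ - 2 * K * t) ^ 2 / (4 * t) := by field_simp; ring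
  have : 0 ≤ (‖x - y‖ - 2 * K * t) ^ 2 / (4 * t) := by positivity
  linarith

theorem hopfLax_le (hK : LipschitzWith K φ) (ht : 0 < t) (x y : V) :
    hopfLax φ t x ≤ ‖x - y‖ ^ 2 / (2 * t) + φ y := by
  refine ciInf_le ⟨φ x - K ^ 2 * t, ?_⟩ y
  rintro _ ⟨y, rfl⟩
  have : 0 ≤ ‖x - y‖ ^ 2 / (4 * t) := by positivity
  have := add_sq_norm_sub_le hK ht x y
  dsimp only
  linarith

theorem hopfLax_add_le (hK : LipschitzWith K φ) (ht : 0 < t) (hθ0 : 0 ≤ θ) (hθ1 : θ ≤ 1) (x y : V) :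
    hopfLax φ t x + θ * (‖x - y‖ ^ 2 / (4 * t) - K ^ 2 * t) ≤ ‖x - y‖ ^ 2 / (2 * t) + φ y := by
  have hopfLax_le_self : hopfLax φ t x ≤ φ x := by simpa using hopfLax_le hK ht x x
  have hinf := mul_le_mul_of_nonneg_left (hopfLax_le hK ht x y) (sub_nonneg.2 hθ1)
  have hsq := mul_le_mul_of_nonneg_left (add_sq_norm_sub_le hK ht x y) hθ0
  have := mul_le_mul_of_nonneg_left hopfLax_le_self hθ0
  linarith

end HopfLax

section Preliminaries

theorem integral_eq_pow_smul_integral_comp_add_smul {V F : Type*} [NormedAddCommGroup V]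
    [InnerProductSpace ℝ V] [FiniteDimensional ℝ V] [MeasurableSpace V] [BorelSpace V]
    [NormedAddCommGroup F] [NormedSpace ℝ F] (g : V → F) {σ : ℝ} (hσ : 0 < σ) (x : V) :
    ∫ y, g y = σ ^ Module.finrank ℝ V • ∫ w, g (x + σ • w) := by
  rw [Measure.integral_comp_smul volume (fun w => g (x + w)), integral_add_left_eq_self g x,
    abs_of_pos (by positivity), smul_smul, mul_inv_cancel₀ (by positivity), one_smul]

theorem sq_norm_sub_add_sqrt_smul {V : Type*} [NormedAddCommGroup V] [NormedSpace ℝ V] {s : ℝ}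
    (hs : 0 ≤ s) (x w : V) : ‖x - (x + √s • w)‖ ^ 2 = s * ‖w‖ ^ 2 := by
  rw [sub_add_cancel_left, norm_neg, norm_smul, mul_pow, Real.norm_eq_abs, sq_abs, Real.sq_sqrt hs]

theorem le_add_of_concaveOn_of_hasFDerivAt {E : Type*} [NormedAddCommGroup E] [NormedSpace ℝ E]
    {f : E → ℝ} {f' : E →L[ℝ] ℝ} {a : E} (hf : ConcaveOn ℝ univ f) (hf' : HasFDerivAt f f' a)
    (b : E) : f b ≤ f a + f' (b - a) := by
  have hline : ConcaveOn ℝ univ (f ∘ AffineMap.lineMap a b) :=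
    hf.comp_affineMap (AffineMap.lineMap a b : ℝ →ᵃ[ℝ] E)
  have hderiv : HasDerivAt (f ∘ AffineMap.lineMap a b) (f' (b - a)) (0 : ℝ) :=
    HasFDerivAt.comp_hasDerivAt 0 (by simpa using hf') AffineMap.hasDerivAt_lineMap
  have hslope := hline.slope_le_of_hasDerivAt (mem_univ 0) (mem_univ 1) one_pos hderiv
  simp only [slope_def_field, Function.comp_apply, AffineMap.lineMap_apply_one,
    AffineMap.lineMap_apply_zero, sub_zero, div_one] at hslope
  linarith

theorem lipschitzWith_neg_div {α : Type*} [PseudoMetricSpace α] {f : α → ℝ}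
    {K : ℝ≥0} {ε : ℝ} (hf : LipschitzWith K f) (hε : 0 < ε) :
    LipschitzWith (K / ε.toNNReal) (fun y => -f y / ε) := by
  refine LipschitzWith.of_dist_le_mul fun x y => ?_
  have hdist := hf.dist_le_mul x y
  rw [Real.dist_eq] at hdist ⊢
  rw [NNReal.coe_div, Real.coe_toNNReal _ hε.le, ← sub_div, neg_sub_neg, abs_div, abs_sub_comm,
    abs_of_pos hε, div_mul_eq_mul_div]
  gcongr

theorem tendsto_mul_log_const_div {c : ℝ} (hc : c ≠ 0) :
    Tendsto (fun ε : ℝ => ε * Real.log (c / ε)) (𝓝[>] 0) (𝓝 0) := by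
  have hlin : Tendsto (fun ε : ℝ => ε * Real.log c) (𝓝[>] 0) (𝓝 0) := by
    simpa using ((continuous_mul_const (Real.log c)).tendsto 0).mono_left nhdsWithin_le_nhds
  have hlog : Tendsto (fun ε : ℝ => Real.log ε * ε) (𝓝[>] 0) (𝓝 0) := by
    simpa using tendsto_log_mul_rpow_nhdsGT_zero one_pos
  refine (sub_zero (0 : ℝ) ▸ hlin.sub hlog).congr' ?_
  filter_upwards [self_mem_nhdsWithin] with ε hε
  rw [Real.log_div hc (ne_of_gt hε)]
  ring

end Preliminaries

section ColeHopf

variable {d : ℕ} {φ : EuclideanSpace ℝ (Fin d) → ℝ} {K : ℝ≥0} {lam ε t : ℝ}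

theorem integral_exp_sub_div_eq (φ : EuclideanSpace ℝ (Fin d) → ℝ) (hε : 0 < ε) (ht : 0 < t)
    (x : EuclideanSpace ℝ (Fin d)) :
    ∫ y, Real.exp (-‖x - y‖ ^ 2 / (2 * ε * t) - φ y / ε) =
      √(ε * t) ^ d * gaussMass (fun y => -φ y / ε) √(ε * t) x := by
  have hεt : 0 < ε * t := mul_pos hε ht
  rw [integral_eq_pow_smul_integral_comp_add_smul _ (Real.sqrt_pos.2 hεt) x,
    finrank_euclideanSpace_fin, smul_eq_mul, gaussMass]
  congr! 3 with w
  rw [gaussWeight, sq_norm_sub_add_sqrt_smul hεt.le]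
  congr 1
  field_simp
  ring

theorem colePotential_eq (hK : LipschitzWith K φ) (hε : 0 < ε) (ht : 0 < t)
    (x : EuclideanSpace ℝ (Fin d)) :
    colePotential φ ε t x = ε * (d / 2 * Real.log (2 * Real.pi)) -
      ε * Real.log (gaussMass (fun y => -φ y / ε) √(ε * t) x) := by
  have hεt : 0 < ε * t := mul_pos hε ht
  have mass_pos := gaussMass_pos (lipschitzWith_neg_div hK hε) √(ε * t) x
  have normalization : (2 * Real.pi * ε * t) ^ ((d : ℝ) / 2) =
      (2 * Real.pi) ^ ((d : ℝ) / 2) * √(ε * t) ^ d := by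
    rw [mul_assoc, Real.mul_rpow (by positivity) hεt.le, Real.rpow_div_two_eq_sqrt _ hεt.le,
      Real.rpow_natCast]
  rw [colePotential, integral_exp_sub_div_eq φ hε ht, normalization, one_div, mul_inv, mul_assoc,
    inv_mul_cancel_left₀ (by positivity), Real.log_mul (by positivity) mass_pos.ne', Real.log_inv,
    Real.log_rpow (by positivity)]
  ring

theorem hasGradientAt_colePotential (hK : LipschitzWith K φ) (hε : 0 < ε) (ht : 0 < t)
    (x : EuclideanSpace ℝ (Fin d)) :
    HasGradientAt (colePotential φ ε t)
      (-(ε / √(ε * t)) • gaussMean (fun y => -φ y / ε) √(ε * t) x) x := by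
  have hσ : √(ε * t) ≠ 0 := (Real.sqrt_pos.2 (mul_pos hε ht)).ne'
  have hlog := hasGradientAt_log_gaussMass (lipschitzWith_neg_div hK hε) hσ x
  rw [hasGradientAt_iff_hasFDerivAt] at hlog ⊢
  rw [funext (colePotential_eq hK hε ht)]
  convert! (hlog.const_mul ε).const_sub (ε * (d / 2 * Real.log (2 * Real.pi))) using 1
  rw [map_smul, map_smul, smul_smul, neg_smul, div_eq_mul_inv]

theorem velocity_eq (hK : LipschitzWith K φ) (hε : 0 < ε) (ht : 0 < t)
    (x : EuclideanSpace ℝ (Fin d)) :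
    velocity φ ε t x = -(ε / √(ε * t)) • gaussMean (fun y => -φ y / ε) √(ε * t) x :=
  (hasGradientAt_colePotential hK hε ht x).gradient

theorem hasFDerivAt_colePotential (hK : LipschitzWith K φ) (hε : 0 < ε) (ht : 0 < t)
    (x : EuclideanSpace ℝ (Fin d)) :
    HasFDerivAt (colePotential φ ε t) (innerSL ℝ (velocity φ ε t x)) x := by
  rw [velocity_eq hK hε ht]
  exact (hasGradientAt_colePotential hK hε ht x).hasFDerivAt

theorem lipschitzWith_colePotential (hK : LipschitzWith K φ) (hε : 0 < ε) (ht : 0 < t) :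
    LipschitzWith K (colePotential φ ε t) := by
  refine LipschitzWith.of_dist_le_mul fun x y => ?_
  have hlog :=
    (lipschitzWith_log_gaussMass (lipschitzWith_neg_div hK hε) √(ε * t)).dist_le_mul x y
  rw [Real.dist_eq, NNReal.coe_div, Real.coe_toNNReal _ hε.le, div_mul_eq_mul_div,
    le_div_iff₀ hε] at hlog
  rw [Real.dist_eq, colePotential_eq hK hε ht, colePotential_eq hK hε ht,
    sub_sub_sub_cancel_left, ← mul_sub, abs_mul, abs_of_pos hε, abs_sub_comm]
  linarith

theorem norm_velocity_le (hK : LipschitzWith K φ) (hε : 0 < ε) (ht : 0 < t)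
    (x : EuclideanSpace ℝ (Fin d)) : ‖velocity φ ε t x‖ ≤ K := by
  have hnorm := norm_fderiv_le_of_lipschitz ℝ (lipschitzWith_colePotential hK hε ht) (x₀ := x)
  rwa [(hasFDerivAt_colePotential hK hε ht x).fderiv, innerSL_apply_norm] at hnorm

theorem LambdaConcave.strongConvexOn_neg_div (hφ : LambdaConcave lam φ) (hε : 0 < ε) :
    StrongConvexOn univ (-lam / ε) (fun y => -φ y / ε) := by
  rw [strongConvexOn_iff_convex]
  refine ((ConcaveOn.neg hφ).smul (inv_nonneg.2 hε.le)).congr fun y _ => ?_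
  simp only [Pi.neg_apply, smul_eq_mul]
  ring

theorem LambdaConcave.colePotential (hφ : LambdaConcave lam φ) (hK : LipschitzWith K φ)
    (hε : 0 < ε) (ht : 0 < t) : LambdaConcave lam (colePotential φ ε t) := by
  have hlog := strongConvexOn_log_gaussMass (lipschitzWith_neg_div hK hε)
    (hφ.strongConvexOn_neg_div hε) √(ε * t)
  rw [strongConvexOn_iff_convex] at hlog
  refine ((hlog.smul hε.le).neg.add_const (ε * (d / 2 * Real.log (2 * Real.pi)))).congr
    fun x _ => ?_
  simp only [Pi.neg_apply, Pi.add_apply, smul_eq_mul]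
  rw [colePotential_eq hK hε ht]
  field_simp
  ring

theorem LambdaConcave.le_add_inner {u : EuclideanSpace ℝ (Fin d) → ℝ}
    (hu : LambdaConcave lam u) {a v : EuclideanSpace ℝ (Fin d)}
    (hv : HasFDerivAt u (innerSL ℝ v) a) (b : EuclideanSpace ℝ (Fin d)) :
    u b ≤ u a + inner ℝ v (b - a) + lam / 2 * ‖b - a‖ ^ 2 := by
  have htangent := le_add_of_concaveOn_of_hasFDerivAt hu
    (hv.sub ((hasStrictFDerivAt_norm_sq a).hasFDerivAt.const_mul (lam / 2))) b
  simp only [sub_apply, smul_apply, innerSL_apply_apply,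
    smul_eq_mul, nsmul_eq_mul, Nat.cast_ofNat, inner_sub_right, real_inner_self_eq_norm_sq]
    at htangent
  rw [inner_sub_right, norm_sub_sq_real, real_inner_comm a b]
  linarith

theorem le_colePotential (hK : LipschitzWith K φ) (hε : 0 < ε) (hε1 : ε ≤ 1) (ht : 0 < t)
    (x : EuclideanSpace ℝ (Fin d)) :
    hopfLax φ t x - ε * (d / 2 * Real.log (2 / ε)) - ε * (K ^ 2 * t) ≤
      colePotential φ ε t x := by
  have hεt : 0 < ε * t := mul_pos hε ht
  have exponent_le (w : EuclideanSpace ℝ (Fin d)) :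
      -(1 / 2) * ‖w‖ ^ 2 + -φ (x + √(ε * t) • w) / ε ≤
        (-hopfLax φ t x / ε + K ^ 2 * t) - ε * (‖w‖ ^ 2 / 4) := by
    have hle := div_le_div_of_nonneg_right
      (hopfLax_add_le hK ht hε.le hε1 x (x + √(ε * t) • w)) hε.le
    rw [sq_norm_sub_add_sqrt_smul hεt.le] at hle
    field_simp at hle ⊢
    linarith
  have hlog := mul_le_mul_of_nonneg_left
    (log_gaussMass_le (lipschitzWith_neg_div hK hε) hε exponent_le) hε.le
  rw [finrank_euclideanSpace_fin, mul_add, mul_add, mul_div_cancel₀ _ hε.ne'] at hlog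
  rw [colePotential_eq hK hε ht]
  linarith

theorem exists_colePotential_le (hK : LipschitzWith K φ) : ∃ C : ℝ, 0 ≤ C ∧
    ∀ ε t : ℝ, 0 < ε → 0 < t → ∀ x, colePotential φ ε t x ≤ hopfLax φ t x + C * √(ε * t) := by
  obtain ⟨c, hc, hle⟩ := exists_le_log_gaussMass (EuclideanSpace ℝ (Fin d))
  refine ⟨K * c, by positivity, fun ε t hε ht x => ?_⟩
  have hεt : 0 < ε * t := mul_pos hε ht
  rw [← sub_le_iff_le_add]
  refine le_ciInf fun y => ?_
  obtain ⟨p, rfl⟩ : ∃ p, x + √(ε * t) • p = y :=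
    ⟨(√(ε * t))⁻¹ • (y - x), by rw [smul_inv_smul₀ (by positivity), add_sub_cancel]⟩
  have hlog := mul_le_mul_of_nonneg_left
    (hle _ _ (lipschitzWith_neg_div hK hε) _ (Real.sqrt_nonneg (ε * t)) x p) hε.le
  rw [finrank_euclideanSpace_fin, NNReal.coe_div, Real.coe_toNNReal _ hε.le] at hlog
  rw [colePotential_eq hK hε ht, sq_norm_sub_add_sqrt_smul hεt.le]
  field_simp at hlog ⊢
  linarith

theorem exists_abs_colePotential_sub_hopfLax_le (hK : LipschitzWith K φ) (T : ℝ) :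
    ∃ η : ℝ → ℝ, Tendsto η (𝓝[>] 0) (𝓝 0) ∧ ∀ ε t : ℝ, 0 < ε → ε ≤ 1 → 0 < t → t ≤ T →
      ∀ x, |colePotential φ ε t x - hopfLax φ t x| ≤ η ε := by
  obtain ⟨C, hC, hup⟩ := exists_colePotential_le hK
  refine ⟨fun ε => d / 2 * (ε * Real.log (2 / ε)) + (ε * (K ^ 2 * T) + C * √(ε * T)), ?_,
    fun ε t hε hε1 ht htT x => ?_⟩
  · have hcont : Continuous (fun ε : ℝ => ε * (K ^ 2 * T) + C * √(ε * T)) := by fun_prop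
    simpa using ((tendsto_mul_log_const_div two_ne_zero).const_mul ((d : ℝ) / 2)).add
      ((hcont.tendsto 0).mono_left nhdsWithin_le_nhds)
  · have hT : 0 < T := ht.trans_le htT
    have lower := le_colePotential hK hε hε1 ht x
    have upper := hup ε t hε ht x
    have sq_mono : ε * (K ^ 2 * t) ≤ ε * (K ^ 2 * T) := by gcongr
    have sqrt_mono : C * √(ε * t) ≤ C * √(ε * T) := by gcongr
    have log_nonneg : 0 ≤ Real.log (2 / ε) := Real.log_nonneg (by rw [le_div_iff₀ hε]; linarith)
    have : 0 ≤ ε * (d / 2 * Real.log (2 / ε)) := by positivity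
    have : 0 ≤ ε * (K ^ 2 * T) := by positivity
    have : 0 ≤ C * √(ε * T) := by positivity
    rw [abs_le]
    constructor <;> linarith

end ColeHopf

section BoundedDisplacement

variable {E : Type*} [PseudoMetricSpace E] [ProperSpace E] [MeasurableSpace E] [BorelSpace E]
  {μ : Measure E} [IsLocallyFiniteMeasure μ] {R : ℝ}

theorem isLocallyFiniteMeasure_map_of_dist_le {F : E → E} (hF : Measurable F)
    (hR : ∀ y, dist (F y) y ≤ R) : IsLocallyFiniteMeasure (Measure.map F μ) := by
  refine ⟨fun x => ⟨Metric.closedBall x 1, Metric.closedBall_mem_nhds x one_pos, ?_⟩⟩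
  rw [Measure.map_apply hF Metric.isClosed_closedBall.measurableSet]
  refine (measure_mono (t := Metric.closedBall x (R + 1)) fun y hy => ?_).trans_lt
    (isCompact_closedBall x (R + 1)).measure_lt_top
  calc dist y x ≤ dist (F y) y + dist (F y) x := dist_triangle_left y x (F y)
    _ ≤ R + 1 := add_le_add (hR y) hy

theorem tendsto_integral_comp_of_dist_le {ι : Type*} {l : Filter ι} [l.IsCountablyGenerated]
    {F : ι → E → E} {G : E → E} (hF : ∀ᶠ i in l, Measurable (F i))
    (hR : ∀ᶠ i in l, ∀ y, dist (F i y) y ≤ R) (hlim : ∀ y, Tendsto (fun i => F i y) l (𝓝 (G y)))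
    {g : E → ℝ} (hg : Continuous g) (hgc : HasCompactSupport g) :
    Tendsto (fun i => ∫ y, g (F i y) ∂μ) l (𝓝 (∫ y, g (G y) ∂μ)) := by
  obtain ⟨M, hM⟩ := hg.bounded_above_of_compact_support hgc
  have hcompact : IsCompact (Metric.cthickening R (tsupport g)) := hgc.isCompact.cthickening
  have hmeas := (Metric.isClosed_cthickening (δ := R) (E := tsupport g)).measurableSet
  refine tendsto_integral_filter_of_dominated_convergence
    ((Metric.cthickening R (tsupport g)).indicator fun _ => M) ?_ ?_ ?_ ?_
  · exact hF.mono fun i hi => (hg.measurable.comp hi).aestronglyMeasurable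
  · refine hR.mono fun i hi => Eventually.of_forall fun y => ?_
    by_cases hy : F i y ∈ tsupport g
    · rw [indicator_of_mem
        (Metric.mem_cthickening_of_dist_le y (F i y) R _ hy ((dist_comm _ _).trans_le (hi y)))]
      exact hM _
    · rw [image_eq_zero_of_notMem_tsupport hy, norm_zero]
      exact indicator_nonneg (fun _ _ => (norm_nonneg _).trans (hM y)) y
  · rw [integrable_indicator_iff hmeas]
    exact integrableOn_const hcompact.measure_lt_top.ne
  · exact Eventually.of_forall fun y => (hg.tendsto _).comp (hlim y)

end BoundedDisplacement

section WeakStar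

variable {d : ℕ} {μ μ' : ℝ → Measure (EuclideanSpace ℝ (Fin d))}
  {ν : Measure (EuclideanSpace ℝ (Fin d))}
  {F : ℝ → EuclideanSpace ℝ (Fin d) → EuclideanSpace ℝ (Fin d)}

theorem LocallyWeakStarTendsto.congr' (hμ : LocallyWeakStarTendsto μ ν) (h : μ =ᶠ[𝓝[>] 0] μ') :
    LocallyWeakStarTendsto μ' ν := fun g hg hgc =>
  (hμ g hg hgc).congr' (h.mono fun s hs => by rw [hs])

theorem locallyWeakStarTendsto_map {G : EuclideanSpace ℝ (Fin d) → EuclideanSpace ℝ (Fin d)}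
    {R : ℝ} (hF : ∀ᶠ s in 𝓝[>] 0, Measurable (F s)) (hG : Measurable G)
    (hR : ∀ᶠ s in 𝓝[>] 0, ∀ y, dist (F s y) y ≤ R)
    (hlim : ∀ y, Tendsto (fun s => F s y) (𝓝[>] 0) (𝓝 (G y))) :
    LocallyWeakStarTendsto (fun s => Measure.map (F s) volume) (Measure.map G volume) := by
  intro g hg hgc
  rw [integral_map hG.aemeasurable hg.aestronglyMeasurable]
  refine (tendsto_integral_comp_of_dist_le hF hR hlim hg hgc).congr' ?_
  filter_upwards [hF] with s hs
  rw [integral_map hs.aemeasurable hg.aestronglyMeasurable]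

theorem locallyWeakStarTendsto_map_volume {C : ℝ≥0} (hF : ∀ s, 0 ≤ s → Measurable (F s))
    (hC : ∀ s, 0 ≤ s → ∀ y, dist (F s y) y ≤ C * s) :
    LocallyWeakStarTendsto (fun s => Measure.map (F s) volume) volume := by
  have hlim (y) : Tendsto (fun s => F s y) (𝓝[>] 0) (𝓝 (id y)) := by
    have hlin : Tendsto (fun s : ℝ => C * s) (𝓝[>] 0) (𝓝 0) := by
      simpa using ((continuous_const_mul (C : ℝ)).tendsto 0).mono_left nhdsWithin_le_nhds
    refine tendsto_iff_dist_tendsto_zero.2 (squeeze_zero' (.of_forall fun _ => dist_nonneg) ?_ hlin)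
    filter_upwards [self_mem_nhdsWithin] with s hs using hC s (le_of_lt hs) y
  have hweak := locallyWeakStarTendsto_map (R := C)
    (eventually_nhdsWithin_of_forall fun s hs => hF s (le_of_lt hs)) measurable_id
    (by filter_upwards [Ioc_mem_nhdsGT one_pos] with s hs y using
      (hC s hs.1.le y).trans (mul_le_of_le_one_right C.2 hs.2)) hlim
  rwa [Measure.map_id] at hweak

end WeakStar

section LagrangianFlow

variable {d : ℕ} {φ : EuclideanSpace ℝ (Fin d) → ℝ} {K : ℝ≥0} {lam ε δ t T : ℝ}
  {Y Y' : EuclideanSpace ℝ (Fin d) → ℝ → EuclideanSpace ℝ (Fin d)}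

/-- The viscous velocity field in the time variable `s = √t`, namely `2 s v^ε_{s²}`, written as a
Gaussian mean so that it is defined, and regular, up to `s = 0`. -/
noncomputable def rescaledVelocity (φ : EuclideanSpace ℝ (Fin d) → ℝ) (ε s : ℝ)
    (x : EuclideanSpace ℝ (Fin d)) : EuclideanSpace ℝ (Fin d) :=
  -(2 * √ε) • gaussMean (fun y => -φ y / ε) (√ε * s) x

theorem rescaledVelocity_eq (hK : LipschitzWith K φ) (hε : 0 < ε) {s : ℝ} (hs : 0 < s)
    (x : EuclideanSpace ℝ (Fin d)) :
    rescaledVelocity φ ε s x = (2 * s) • velocity φ ε (s ^ 2) x := by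
  have : 0 < √ε := Real.sqrt_pos.2 hε
  rw [velocity_eq hK hε (by positivity), Real.sqrt_mul hε.le, Real.sqrt_sq hs.le,
    rescaledVelocity, smul_smul]
  congr 1
  nth_rw 2 [← Real.mul_self_sqrt hε.le]
  field_simp

theorem abs_sqrt_mul_le {s S : ℝ} (hs : s ∈ Icc 0 S) : |√ε * s| ≤ √ε * S := by
  rw [abs_of_nonneg (mul_nonneg (Real.sqrt_nonneg _) hs.1)]
  exact mul_le_mul_of_nonneg_left hs.2 (Real.sqrt_nonneg _)

theorem exists_lipschitzWith_rescaledVelocity (hK : LipschitzWith K φ) (hε : 0 < ε) (S : ℝ) :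
    ∃ L : ℝ≥0, ∀ s ∈ Icc 0 S, LipschitzWith L (rescaledVelocity φ ε s) := by
  obtain ⟨L, hL⟩ := exists_lipschitzWith_gaussMean (lipschitzWith_neg_div hK hε) (√ε * S)
  exact ⟨_, fun s hs => (lipschitzWith_smul (-(2 * √ε))).comp (hL _ (abs_sqrt_mul_le hs))⟩

theorem exists_norm_rescaledVelocity_le (hK : LipschitzWith K φ) (hε : 0 < ε) (S : ℝ) :
    ∃ B : ℝ≥0, ∀ s ∈ Icc 0 S, ∀ x, ‖rescaledVelocity φ ε s x‖ ≤ B := by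
  have hlip := lipschitzWith_neg_div hK hε
  obtain ⟨M, hM⟩ := exists_integral_norm_mul_gaussWeight_le hlip (√ε * S)
  refine ⟨‖-(2 * √ε)‖₊ * M, fun s hs x => ?_⟩
  rw [rescaledVelocity, norm_smul, NNReal.coe_mul, coe_nnnorm]
  gcongr
  exact norm_gaussMean_le hlip (hM _ (abs_sqrt_mul_le hs) x)

theorem continuous_rescaledVelocity (hK : LipschitzWith K φ) (hε : 0 < ε)
    (x : EuclideanSpace ℝ (Fin d)) : Continuous (fun s => rescaledVelocity φ ε s x) :=
  ((continuous_gaussMean (lipschitzWith_neg_div hK hε) x).comp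
    (continuous_const_mul √ε)).const_smul (-(2 * √ε))

theorem IsLagrangianFlow.isIntegralCurveOn (hY : IsLagrangianFlow φ ε Y) (hK : LipschitzWith K φ)
    (hε : 0 < ε) (y : EuclideanSpace ℝ (Fin d)) :
    IsIntegralCurveOn (fun s => Y y (s ^ 2)) (rescaledVelocity φ ε) (Ici 0) := by
  have hcont : ContinuousOn (fun s => Y y (s ^ 2)) (Ici 0) :=
    (hY.continuousOn y).comp (by fun_prop) fun s _ => sq_nonneg s
  refine isIntegralCurveOn_Ici_of_hasDerivAt hcont (fun s hs => ?_)
    (continuousOn_comp_of_lipschitzWith (exists_lipschitzWith_rescaledVelocity hK hε)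
      (fun x => (continuous_rescaledVelocity hK hε x).continuousOn) hcont)
  rw [rescaledVelocity_eq hK hε hs]
  have hsq : HasDerivAt (fun s : ℝ => s ^ 2) (2 * s) s := by simpa using hasDerivAt_pow 2 s
  exact (hY.hasDerivAt y (s ^ 2) (by positivity)).scomp s hsq

theorem exists_isLagrangianFlow (hK : LipschitzWith K φ) (hε : 0 < ε) :
    ∃ Y, IsLagrangianFlow φ ε Y := by
  choose Z hZ0 hZ using exists_isIntegralCurveOn_Ici
    (exists_lipschitzWith_rescaledVelocity hK hε)
    (fun x => (continuous_rescaledVelocity hK hε x).continuousOn)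
    (exists_norm_rescaledVelocity_le hK hε)
  refine ⟨fun y t => Z y √t, fun y => by rw [Real.sqrt_zero, hZ0], fun y => ?_, fun y t ht => ?_⟩
  · exact (hZ y).continuousOn.comp (by fun_prop) fun t _ => Real.sqrt_nonneg t
  · have hs : 0 < √t := Real.sqrt_pos.2 ht
    have hderiv := ((hZ y √t hs.le).hasDerivAt (Ici_mem_nhds hs)).scomp t
      (Real.hasDerivAt_sqrt ht.ne')
    rwa [rescaledVelocity_eq hK hε hs, Real.sq_sqrt ht.le, smul_smul,
      one_div_mul_cancel (by positivity), one_smul] at hderiv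

theorem IsLagrangianFlow.isOrientedBilipschitz (hY : IsLagrangianFlow φ ε Y)
    (hK : LipschitzWith K φ) (hε : 0 < ε) (ht : 0 ≤ t) :
    IsOrientedBilipschitz volume (fun y => Y y t) := by
  obtain ⟨L, hL⟩ := exists_lipschitzWith_rescaledVelocity hK hε √t
  simpa only [Real.sq_sqrt ht] using isOrientedBilipschitz_flow (μ := volume)
    (fun y => by rw [zero_pow two_ne_zero, hY.initial]) (hY.isIntegralCurveOn hK hε)
    (Real.sqrt_nonneg t) hL

theorem IsLagrangianFlow.measurable (hY : IsLagrangianFlow φ ε Y)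
    (hK : LipschitzWith K φ) (hε : 0 < ε) (ht : 0 ≤ t) : Measurable (fun y => Y y t) := by
  obtain ⟨C, hC⟩ := (hY.isOrientedBilipschitz hK hε ht).lipschitz
  exact hC.continuous.measurable

theorem IsLagrangianFlow.viscousMass_eq_map (hY : IsLagrangianFlow φ ε Y)
    (hK : LipschitzWith K φ) (hε : 0 < ε) (ht : 0 ≤ t) :
    viscousMass (fun y => Y y t) = Measure.map (fun y => Y y t) volume :=
  AdhesionModel.viscousMass_eq_map (hY.isOrientedBilipschitz hK hε ht)

theorem IsLagrangianFlow.dist_le (hY : IsLagrangianFlow φ ε Y) (hK : LipschitzWith K φ)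
    (hε : 0 < ε) (ht : 0 ≤ t) (y : EuclideanSpace ℝ (Fin d)) : dist (Y y t) y ≤ K * t := by
  rcases ht.eq_or_lt with rfl | ht
  · rw [hY.initial, dist_self, mul_zero]
  · have hle := norm_sub_le_of_hasDerivAt_Ioo ht ((hY.continuousOn y).mono Icc_subset_Ici_self)
      (fun s hs => hY.hasDerivAt y s hs.1) (fun s hs => norm_velocity_le hK hε hs.1 _)
    rwa [hY.initial, sub_zero, ← dist_eq_norm] at hle

theorem inner_velocity_sub_le (hK : LipschitzWith K φ) (hφ : LambdaConcave lam φ) (hε : 0 < ε)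
    (hδ : 0 < δ) (ht : 0 < t) {e : ℝ}
    (he : ∀ x, |colePotential φ ε t x - colePotential φ δ t x| ≤ e)
    (a b : EuclideanSpace ℝ (Fin d)) :
    inner ℝ (a - b) (velocity φ ε t a - velocity φ δ t b) ≤ 2 * e + lam * ‖a - b‖ ^ 2 := by
  have tangent_at_a :=
    (hφ.colePotential hK hε ht).le_add_inner (hasFDerivAt_colePotential hK hε ht a) b
  have tangent_at_b :=
    (hφ.colePotential hK hδ ht).le_add_inner (hasFDerivAt_colePotential hK hδ ht b) a
  have at_a := (abs_le.1 (he a)).2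
  have at_b := (abs_le.1 (he b)).1
  rw [norm_sub_rev, ← neg_sub a b, inner_neg_right, real_inner_comm] at tangent_at_a
  rw [real_inner_comm] at tangent_at_b
  rw [inner_sub_right]
  linarith

theorem IsLagrangianFlow.sq_norm_sub_le (hY : IsLagrangianFlow φ ε Y)
    (hY' : IsLagrangianFlow φ δ Y') (hK : LipschitzWith K φ) (hlam : 0 ≤ lam)
    (hφ : LambdaConcave lam φ) (hε : 0 < ε) (hδ : 0 < δ) {e : ℝ} (he0 : 0 ≤ e) (ht : t ∈ Icc 0 T)
    (he : ∀ s ∈ Ioc 0 T, ∀ x, |colePotential φ ε s x - colePotential φ δ s x| ≤ e)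
    (y : EuclideanSpace ℝ (Fin d)) :
    ‖Y y t - Y' y t‖ ^ 2 ≤ Real.exp (2 * lam * T) * (4 * T) * e := by
  have hsub : Icc 0 t ⊆ Ici (0 : ℝ) := Icc_subset_Ici_self
  have gronwall := le_exp_mul_of_hasDerivAt_le (q := fun s => ‖Y y s - Y' y s‖ ^ 2)
    (c := 2 * lam) (m := 4 * e) ht.1 (by positivity) (by positivity)
    (((((hY.continuousOn y).mono hsub).sub ((hY'.continuousOn y).mono hsub)).norm).pow 2)
    (fun s hs => ((hY.hasDerivAt y s hs.1).sub (hY'.hasDerivAt y s hs.1)).norm_sq)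
    (fun s hs => by
      have := inner_velocity_sub_le hK hφ hε hδ hs.1 (he s ⟨hs.1, hs.2.le.trans ht.2⟩)
        (Y y s) (Y' y s)
      simp only [Pi.sub_apply]
      linarith)
  simp only [hY.initial, hY'.initial, sub_self, norm_zero, sub_zero, zero_pow two_ne_zero,
    zero_add] at gronwall
  calc ‖Y y t - Y' y t‖ ^ 2 ≤ Real.exp (2 * lam * t) * (4 * e * t) := gronwall
    _ ≤ Real.exp (2 * lam * T) * (4 * e * T) := by
      have := ht.1
      gcongr <;> exact ht.2
    _ = Real.exp (2 * lam * T) * (4 * T) * e := by ring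

end LagrangianFlow

section VanishingViscosity

variable {d : ℕ} {φ : EuclideanSpace ℝ (Fin d) → ℝ} {K : ℝ≥0} {lam t : ℝ}
  {Xeps : ℝ → EuclideanSpace ℝ (Fin d) → ℝ → EuclideanSpace ℝ (Fin d)}

theorem uniformCauchySeqOn_flow (hK : LipschitzWith K φ) (hlam : 0 ≤ lam)
    (hφ : LambdaConcave lam φ) (hX : ∀ ε : ℝ, 0 < ε → IsLagrangianFlow φ ε (Xeps ε)) (T : ℝ) :
    UniformCauchySeqOn (fun ε p => Xeps ε p.1 p.2) (𝓝[>] 0)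
      ((univ : Set (EuclideanSpace ℝ (Fin d))) ×ˢ Icc 0 T) := by
  obtain ⟨η, hη, hle⟩ := exists_abs_colePotential_sub_hopfLax_le hK T
  intro u hu
  obtain ⟨r, hr, hru⟩ := Metric.mem_uniformity_dist.1 hu
  have mem_Ioc : ∀ᶠ ε : ℝ in 𝓝[>] 0, ε ∈ Ioc 0 1 := Ioc_mem_nhdsGT one_pos
  have hlim : Tendsto (fun p : ℝ × ℝ => Real.exp (2 * lam * T) * (4 * T) * (|η p.1| + |η p.2|))
      (𝓝[>] 0 ×ˢ 𝓝[>] 0) (𝓝 0) := by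
    simpa using ((hη.comp tendsto_fst).abs.add (hη.comp tendsto_snd).abs).const_mul
      (Real.exp (2 * lam * T) * (4 * T))
  filter_upwards [mem_Ioc.prod_inl (𝓝[>] 0), mem_Ioc.prod_inr (𝓝[>] 0),
    hlim.eventually_lt_const (show 0 < r ^ 2 by positivity)] with ⟨ε, δ⟩ hε hδ hlt
  rintro ⟨y, t⟩ ⟨-, ht⟩
  have potentials_close (s) (hs : s ∈ Ioc 0 T) (x) :
      |colePotential φ ε s x - colePotential φ δ s x| ≤ |η ε| + |η δ| := by
    have hdiff := (abs_sub_le _ (hopfLax φ s x) _).trans (add_le_add (hle ε s hε.1 hε.2 hs.1 hs.2 x)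
      (abs_sub_comm (hopfLax φ s x) _ ▸ hle δ s hδ.1 hδ.2 hs.1 hs.2 x))
    exact hdiff.trans (add_le_add (le_abs_self _) (le_abs_self _))
  have hsq := (hX ε hε.1).sq_norm_sub_le (hX δ hδ.1) hK hlam hφ hε.1 hδ.1 (by positivity) ht
    potentials_close y
  exact hru ((dist_eq_norm _ _).trans_lt (lt_of_pow_lt_pow_left₀ 2 hr.le (hsq.trans_lt hlt)))

/-- The inviscid Lagrangian flow, as the pointwise limit of the viscous flows `Xeps ε`; a junk
value where that limit does not exist. -/
noncomputable def inviscidFlow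
    (Xeps : ℝ → EuclideanSpace ℝ (Fin d) → ℝ → EuclideanSpace ℝ (Fin d))
    (y : EuclideanSpace ℝ (Fin d)) (t : ℝ) : EuclideanSpace ℝ (Fin d) :=
  limUnder (𝓝[>] 0) fun ε => Xeps ε y t

theorem tendsto_inviscidFlow (hK : LipschitzWith K φ) (hlam : 0 ≤ lam) (hφ : LambdaConcave lam φ)
    (hX : ∀ ε : ℝ, 0 < ε → IsLagrangianFlow φ ε (Xeps ε)) (ht : 0 ≤ t)
    (y : EuclideanSpace ℝ (Fin d)) :
    Tendsto (fun ε => Xeps ε y t) (𝓝[>] 0) (𝓝 (inviscidFlow Xeps y t)) :=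
  tendsto_nhds_limUnder (cauchy_map_iff_exists_tendsto.1
    ((uniformCauchySeqOn_flow hK hlam hφ hX t).cauchy_map (x := (y, t)) ⟨mem_univ y, ht, le_rfl⟩))

theorem tendstoUniformlyOn_inviscidFlow (hK : LipschitzWith K φ) (hlam : 0 ≤ lam)
    (hφ : LambdaConcave lam φ) (hX : ∀ ε : ℝ, 0 < ε → IsLagrangianFlow φ ε (Xeps ε))
    {C : Set (EuclideanSpace ℝ (Fin d) × ℝ)} (hC : IsCompact C) (hC0 : C ⊆ univ ×ˢ Ici 0) :
    TendstoUniformlyOn (fun ε p => Xeps ε p.1 p.2) (fun p => inviscidFlow Xeps p.1 p.2)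
      (𝓝[>] 0) C := by
  obtain ⟨T, hT⟩ := (hC.image continuous_snd).bddAbove
  exact ((uniformCauchySeqOn_flow hK hlam hφ hX T).tendstoUniformlyOn_of_tendsto
    fun p hp => tendsto_inviscidFlow hK hlam hφ hX hp.2.1 p.1).mono
      fun p hp => ⟨mem_univ _, (hC0 hp).2, hT (mem_image_of_mem _ hp)⟩

theorem measurable_inviscidFlow (hK : LipschitzWith K φ) (hlam : 0 ≤ lam)
    (hφ : LambdaConcave lam φ) (hX : ∀ ε : ℝ, 0 < ε → IsLagrangianFlow φ ε (Xeps ε))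
    (ht : 0 ≤ t) : Measurable (fun y => inviscidFlow Xeps y t) := by
  have : (comap ((↑) : Ioi (0 : ℝ) → ℝ) (𝓝[>] 0)).NeBot :=
    comap_coe_neBot_of_le_principal inf_le_right
  exact measurable_of_tendsto_metrizable' (comap ((↑) : Ioi (0 : ℝ) → ℝ) (𝓝[>] 0))
    (fun ε => (hX ε ε.2).measurable hK ε.2 ht)
    (tendsto_pi_nhds.2 fun y => (tendsto_inviscidFlow hK hlam hφ hX ht y).comp tendsto_comap)

theorem dist_inviscidFlow_le (hK : LipschitzWith K φ) (hlam : 0 ≤ lam) (hφ : LambdaConcave lam φ)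
    (hX : ∀ ε : ℝ, 0 < ε → IsLagrangianFlow φ ε (Xeps ε)) (ht : 0 ≤ t)
    (y : EuclideanSpace ℝ (Fin d)) : dist (inviscidFlow Xeps y t) y ≤ K * t :=
  le_of_tendsto ((tendsto_inviscidFlow hK hlam hφ hX ht y).dist tendsto_const_nhds)
    (eventually_nhdsWithin_of_forall fun ε hε => (hX ε hε).dist_le hK hε ht y)

theorem locallyWeakStarTendsto_viscousMass (hK : LipschitzWith K φ) (hlam : 0 ≤ lam)
    (hφ : LambdaConcave lam φ) (hX : ∀ ε : ℝ, 0 < ε → IsLagrangianFlow φ ε (Xeps ε))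
    (ht : 0 ≤ t) :
    LocallyWeakStarTendsto (fun ε => viscousMass (fun y => Xeps ε y t))
      (Measure.map (fun y => inviscidFlow Xeps y t) volume) :=
  (locallyWeakStarTendsto_map
    (eventually_nhdsWithin_of_forall fun ε hε => (hX ε hε).measurable hK hε ht)
    (measurable_inviscidFlow hK hlam hφ hX ht)
    (eventually_nhdsWithin_of_forall fun ε hε => (hX ε hε).dist_le hK hε ht)
    (tendsto_inviscidFlow hK hlam hφ hX ht)).congr'
      (eventually_nhdsWithin_of_forall fun ε hε => ((hX ε hε).viscousMass_eq_map hK hε ht).symm)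

end VanishingViscosity

end AdhesionModel

theorem theorem3 {d : ℕ} (φ : EuclideanSpace ℝ (Fin d) → ℝ) (K : ℝ≥0) (lam : ℝ)
    (hK : LipschitzWith K φ) (hlam : 0 ≤ lam) (hφ : AdhesionModel.LambdaConcave lam φ) :
    -- the viscous Lagrangian flows exist
    (∀ ε : ℝ, 0 < ε → ∃ Y, AdhesionModel.IsLagrangianFlow φ ε Y) ∧
    -- whichever representatives of them (at negative times) are used, they have a limit `X`
    ∀ Xeps : ℝ → EuclideanSpace ℝ (Fin d) → ℝ → EuclideanSpace ℝ (Fin d),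
      (∀ ε : ℝ, 0 < ε → AdhesionModel.IsLagrangianFlow φ ε (Xeps ε)) →
      ∃ X : EuclideanSpace ℝ (Fin d) → ℝ → EuclideanSpace ℝ (Fin d),
        (∀ C : Set (EuclideanSpace ℝ (Fin d) × ℝ), IsCompact C → C ⊆ univ ×ˢ Ici 0 →
          TendstoUniformlyOn (fun ε p => Xeps ε p.1 p.2) (fun p => X p.1 p.2) (𝓝[>] 0) C) ∧
        (∀ t : ℝ, 0 ≤ t → Measurable (fun y => X y t)) ∧
        -- the viscous mass measures are the pushforwards of Lebesgue measure
        (∀ ε : ℝ, 0 < ε → ∀ t : ℝ, 0 ≤ t →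
          Measurable (fun y => Xeps ε y t) ∧
          AdhesionModel.viscousMass (fun y => Xeps ε y t) =
            Measure.map (fun y => Xeps ε y t) volume) ∧
        -- all the measures are locally finite
        (∀ ε : ℝ, 0 < ε → ∀ t : ℝ, 0 ≤ t →
          IsLocallyFiniteMeasure (AdhesionModel.viscousMass (fun y => Xeps ε y t))) ∧
        (∀ t : ℝ, 0 ≤ t → IsLocallyFiniteMeasure (Measure.map (fun y => X y t) volume)) ∧
        -- (i) zero-viscosity limit
        (∀ t : ℝ, 0 ≤ t →
          AdhesionModel.LocallyWeakStarTendsto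
            (fun ε => AdhesionModel.viscousMass (fun y => Xeps ε y t))
            (Measure.map (fun y => X y t) volume)) ∧
        -- (ii) initial trace
        AdhesionModel.LocallyWeakStarTendsto
          (fun t => Measure.map (fun y => X y t) volume) volume := by
  refine ⟨fun ε hε => AdhesionModel.exists_isLagrangianFlow hK hε, fun Xeps hX =>
    ⟨AdhesionModel.inviscidFlow Xeps, ?_, ?_, ?_, ?_, ?_, ?_, ?_⟩⟩
  · exact fun C => AdhesionModel.tendstoUniformlyOn_inviscidFlow hK hlam hφ hX
  · exact fun t => AdhesionModel.measurable_inviscidFlow hK hlam hφ hX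
  · exact fun ε hε t ht =>
      ⟨(hX ε hε).measurable hK hε ht, (hX ε hε).viscousMass_eq_map hK hε ht⟩
  · intro ε hε t ht
    rw [(hX ε hε).viscousMass_eq_map hK hε ht]
    exact AdhesionModel.isLocallyFiniteMeasure_map_of_dist_le ((hX ε hε).measurable hK hε ht)
      ((hX ε hε).dist_le hK hε ht)
  · exact fun t ht => AdhesionModel.isLocallyFiniteMeasure_map_of_dist_le
      (AdhesionModel.measurable_inviscidFlow hK hlam hφ hX ht)
      (AdhesionModel.dist_inviscidFlow_le hK hlam hφ hX ht)
  · exact fun t => AdhesionModel.locallyWeakStarTendsto_viscousMass hK hlam hφ hX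
  · exact AdhesionModel.locallyWeakStarTendsto_map_volume
      (fun t => AdhesionModel.measurable_inviscidFlow hK hlam hφ hX)
      (fun t => AdhesionModel.dist_inviscidFlow_le hK hlam hφ hX)
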